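/- For $\tau=\tau_1+i\tau_2$ in the upper half-plane $\mathbb H$ and $z=z_1+iz_2\in\mathbb C$, put $q=e^{2\pi i\tau}$ (with $q^{m^2/2}=e^{\pi i m^2\tau}$), $\zeta^m=e^{2\pi i mz}$ and $$\psi(z;\tau):=i\sum_{m\in\mathbb Z+\frac12}\operatorname{sgn}\Big(m+\frac{z_2}{\tau_2}\Big)(-1)^{m-\frac12}q^{\frac{m^2}{2}}\zeta^m ,\qquad \operatorname{sgn}(0)=0 .$$ All square roots and powers are principal branches, and $\operatorname{erf}(x)=\frac{2}{\sqrt\pi}\int_0^xe^{-t^2}\,dt$. For $\left(\begin{smallmatrix}a&b\\c&d\end{smallmatrix}\right)\in\mathrm{SL}_2(\mathbb Z)$ let $\chi$ be the multiplier of the Dedekind eta function, $$\chi\begin{pmatrix}a&b\\c&d\end{pmatrix}:=\begin{cases}\left(\frac{d}{|c|}\right)e^{\frac{\pi i}{12}\left((a+d)c-bd(c^2-1)-3c\right)}&\text{if $c$ is odd},\\[1mm]\left(\frac{c}{d}\right)e^{\frac{\pi i}{12}\left(ac(1-d^2)+d(b-c+3)-3\right)}&\text{if $c$ is even},\end{cases}$$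 where $\left(\frac{\cdot}{\cdot}\right)$ is the Kronecker symbol. Let $k\ge1$ and $h$ be coprime integers and let $Z\in\mathbb C$ with $\operatorname{Re}(Z)>0$. Put $$K:=\frac{k}{\gcd(k,6)},\quad H:=\frac{6h}{\gcd(k,6)},\quad \alpha_{H,K}:=\frac K2-\frac H6,\quad W:=\frac{6}{\gcd(k,6)}Z,$$ and let $[-H]_K$ be the integer with $0\le[-H]_K<K$ and $-H[-H]_K\equiv1\pmod K$. Let $\sum^{*}_{m}$ (resp. $\sum^{**}_{m}$) denote the sum over those $m\in\mathbb Z+\frac12$ with $|m-\alpha_{H,K}|>\frac1{\gcd(k,6)}$ (resp. $|m-\alpha_{H,K}|\le\frac1{\gcd(k,6)}$; this is a finite sum). Put $$\Psi(z;\tau):=i\,{\sum_{m}}^{*}\operatorname{sgn}\Big(m+\frac{z_2}{\tau_2}\Big)(-1)^{m-\frac12}q^{\frac{m^2}{2}}\zeta^m$$ and, for a rational number $\frac ac$ and $\varepsilon>0$, $$\mathbb E_{\frac ac}(z;\tau):=e^{-\frac{\pi iaz_2^2}{c\tau_2^2}}\int_{\frac ac}^{\tau+i\infty+\varepsilon}e^{\frac{\pi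 iz_2^2}{\tau_2^2}\mathfrak z}\,\frac{{\sum}^{*}_{m}(-1)^{m-\frac12}\left(m+\frac{z_2}{\tau_2}\right)e^{\pi i\left(m^2\mathfrak z+2m\left(z+(\mathfrak z-\tau)\frac{z_2}{\tau_2}\right)\right)}}{\sqrt{i(\mathfrak z-\tau)}}\,d\mathfrak z ,$$ where the path of integration is the segment from $\frac ac$ to $\tau+\varepsilon$ followed by the vertical half-line from $\tau+\varepsilon$ to $\tau+\varepsilon+i\infty$; it lies in $\mathbb H$ apart from its starting point and avoids the branch cut $\tau+i[0,\infty)$ of $\sqrt{i(\mathfrak z-\tau)}$. Let $z\in\mathbb R$, put $\beta:=3z-\frac hk+\frac12$, and let $\varepsilon>0$ be arbitrary. Then all series and integrals below converge absolutely, including the series ${\sum}^{*}_m$ in the integrand of $\mathbb E$ for every $\mathfrak z\in\mathbb H$, and \begin{align*} &\psi\left(3z-\frac hk-\frac{iZ}{k}+\frac12;\,6\left(\frac hk+\frac{iZ}{k}\right)\right) =\chi\begin{pmatrix}[-H]_K&-\frac{H[-H]_K+1}{K}\\K&-H\end{pmatrix}^{-3}(iW)^{-\frac12}e^{-\frac{\pi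 K}{W}\left(\beta-\frac{iZ}{k}\right)^2}\\ &\quad\times\Bigg(\Psi\left(\frac{\beta}{iW}-\frac1{6K};\frac{[-H]_K}{K}+\frac{i}{KW}\right)-ie^{\frac{\pi K\beta^2}{W}}\,\mathbb E_{\frac{[-H]_K}{K}}\left(\frac{\beta}{iW}-\frac1{6K};\frac{[-H]_K}{K}+\frac{i}{KW}\right)\\ &\qquad+i\,{\sum_{m}}^{**}(-1)^{m-\frac12}e^{\pi im^2\left(\frac{[-H]_K}{K}+\frac{i}{KW}\right)+2\pi im\left(\frac{\beta}{iW}-\frac1{6K}\right)}\operatorname{erf}\left(i\left(3Kz+\alpha_{H,K}-m\right)\sqrt{\frac{\pi}{KW}}\right)\Bigg). \end{align*} -/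

import Mathlib

noncomputable section

/-- The error function `erf x = (2 / √π) ∫_0^x exp (-t²) dt` of a complex argument, the integral
being taken along the straight segment `t = s x`, `0 ≤ s ≤ 1`. -/
def cerf (x : ℂ) : ℂ :=
  2 / (Real.sqrt Real.pi : ℂ) * ∫ s in (0 : ℝ)..1, x * Complex.exp (-((s : ℂ) * x) ^ 2)

/-- Principal branch of the complex square root. -/
def csqrt (w : ℂ) : ℂ := w ^ (1 / 2 : ℂ)

/-- The Kronecker symbol `(a / n)` for odd `n` (positive or negative): the Jacobi symbol
`(a / |n|)`, times `(a / -1)` when `n` is negative. -/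
def kroneckerOdd (a n : ℤ) : ℤ :=
  (if n < 0 ∧ a < 0 then -1 else 1) * jacobiSym a n.natAbs

/-- The multiplier `χ` of the Dedekind eta function at the matrix `(a, b; c, d)` of `SL₂(ℤ)`. -/
def etaMultiplier (a b c d : ℤ) : ℂ :=
  if Odd c then
    (kroneckerOdd d |c| : ℂ) *
      Complex.exp (Real.pi * Complex.I / 12 *
        (((a + d) * c - b * d * (c ^ 2 - 1) - 3 * c : ℤ) : ℂ))
  else
    (kroneckerOdd c d : ℂ) *
      Complex.exp (Real.pi * Complex.I / 12 *
        ((a * c * (1 - d ^ 2) + d * (b - c + 3) - 3 : ℤ) : ℂ))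

/-- `[-h]_k`: the residue `0 ≤ x < k` with `-h x ≡ 1 (mod k)` (for `h`, `k` coprime). -/
def negInv (h : ℤ) (k : ℕ) : ℤ := (((-(h : ZMod k))⁻¹).val : ℤ)

/-- `K = k / gcd(k, 6)` (an exact division). -/
def bigK (k : ℕ) : ℕ := k / Nat.gcd k 6

/-- `H = 6 h / gcd(k, 6)` (an exact division). -/
def bigH (h : ℤ) (k : ℕ) : ℤ := 6 * h / (Nat.gcd k 6 : ℤ)

/-- `α_{H,K} = K / 2 - H / 6`. -/
def alphaHK (h : ℤ) (k : ℕ) : ℝ := (bigK k : ℝ) / 2 - (bigH h k : ℝ) / 6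

/-- The half-integer `n + 1/2`. Sums over `m ∈ ℤ + 1/2` are written as sums over `n ∈ ℤ` with
`m = half n`, so that `(-1)^(m - 1/2) = (-1)^n`. -/
def half (n : ℤ) : ℝ := (n : ℝ) + 1 / 2

/-- The `n` whose half-integer `m` satisfies `|m - α_{H,K}| ≤ 1 / gcd(k, 6)`. -/
def nearSet (h : ℤ) (k : ℕ) : Set ℤ :=
  {n : ℤ | |half n - alphaHK h k| ≤ 1 / (Nat.gcd k 6 : ℝ)}

theorem nearSet_finite (h : ℤ) (k : ℕ) : (nearSet h k).Finite := by
  refine (Set.finite_Icc ⌈alphaHK h k - 1 / (Nat.gcd k 6 : ℝ) - 1 / 2⌉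
    ⌊alphaHK h k + 1 / (Nat.gcd k 6 : ℝ) - 1 / 2⌋).subset ?_
  intro n hn
  have hn' : |half n - alphaHK h k| ≤ 1 / (Nat.gcd k 6 : ℝ) := hn
  unfold half at hn'
  rw [abs_le] at hn'
  refine ⟨Int.ceil_le.mpr ?_, Int.le_floor.mpr ?_⟩ <;> linarith [hn'.1, hn'.2]

/-- The finite index set of the sum `∑**`. -/
def near (h : ℤ) (k : ℕ) : Finset ℤ := (nearSet_finite h k).toFinset

/-- The index set of the sum `∑*`: all `n` with `|m - α_{H,K}| > 1 / gcd(k, 6)`. -/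
def far (h : ℤ) (k : ℕ) : Set ℤ := (↑(near h k) : Set ℤ)ᶜ

/-- The summand `sgn(m + z₂/τ₂) (-1)^(m-1/2) q^(m²/2) ζ^m` of the false theta function. -/
def psiTerm (z τ : ℂ) (n : ℤ) : ℂ :=
  (Real.sign (half n + z.im / τ.im) : ℂ) * (-1) ^ n *
    Complex.exp (Real.pi * Complex.I * (half n : ℂ) ^ 2 * τ) *
    Complex.exp (2 * Real.pi * Complex.I * (half n : ℂ) * z)

/-- The false theta function `ψ(z; τ)`. -/
def psi (z τ : ℂ) : ℂ := Complex.I * ∑' n : ℤ, psiTerm z τ n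

/-- The truncated false theta function `Ψ(z; τ)`. -/
def truncPsi (h : ℤ) (k : ℕ) (z τ : ℂ) : ℂ := Complex.I * ∑' n : far h k, psiTerm z τ n

/-- The summand of the series in the integrand of the Eichler integral, at the point `w`. -/
def eichlerTerm (z τ w : ℂ) (n : ℤ) : ℂ :=
  (-1) ^ n * ((half n + z.im / τ.im : ℝ) : ℂ) *
    Complex.exp (Real.pi * Complex.I * ((half n : ℂ) ^ 2 * w +
      2 * (half n : ℂ) * (z + (w - τ) * ((z.im / τ.im : ℝ) : ℂ))))

/-- The integrand of the truncated Eichler integral, at the point `w`. -/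
def truncEichlerIntegrand (h : ℤ) (k : ℕ) (z τ w : ℂ) : ℂ :=
  Complex.exp (Real.pi * Complex.I * ((z.im / τ.im : ℝ) : ℂ) ^ 2 * w) *
    (∑' n : far h k, eichlerTerm z τ w n) / csqrt (Complex.I * (w - τ))

/-- The path from the rational point `r` to `τ + i∞ + ε`, first part: the segment
from `r` to `τ + ε`, with parameter `0 < s ≤ 1`. For `ε > 0` and `Im τ > 0`, the whole path avoids
the half-line `τ + i[0, ∞)`, which is the branch cut of `√(i(w - τ))`. -/
def pathSegment (r : ℝ) (τ : ℂ) (ε s : ℝ) : ℂ := (r : ℂ) + (s : ℂ) * (τ + (ε : ℂ) - (r : ℂ))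

/-- The second part of the path: the vertical half-line from `τ + ε` to `τ + ε + i∞`. -/
def pathRay (τ : ℂ) (ε t : ℝ) : ℂ := τ + (ε : ℂ) + Complex.I * (t : ℂ)

/-- The truncated Eichler integral `𝔼_r(z; τ)` for a rational point `r = a / c`, along the path
from `r` to `τ + i∞ + ε`. -/
def truncEichler (h : ℤ) (k : ℕ) (r ε : ℝ) (z τ : ℂ) : ℂ :=
  Complex.exp (-(Real.pi * Complex.I * (r : ℂ) * ((z.im / τ.im : ℝ) : ℂ) ^ 2)) *
    ((∫ s in Set.Ioc (0 : ℝ) 1,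
        truncEichlerIntegrand h k z τ (pathSegment r τ ε s) * (τ + (ε : ℂ) - (r : ℂ))) +
      ∫ t in Set.Ioi (0 : ℝ), truncEichlerIntegrand h k z τ (pathRay τ ε t) * Complex.I)

end

noncomputable section

open Filter Topology MeasureTheory

/-! ### The complex error function -/

/-! The signs are what spoils the modularity of a false theta function. Write the elliptic variable
as `z = B + A τ` with `A`, `B` real and replace `sgn(m + A)` by `erf(√π (m + A) s)`. The
`s`-derivative of the completed series is twice a unary theta function of weight 3/2 at the point `w
= τ + i s²` (`hasDerivAt_completedFalseTheta`). That theta function is modular, being a combination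
of Jacobi's odd theta function and its `z`-derivative on the line `z = B + A w`
(`ThetaTransforms.unaryTheta_moebius`). The completed series vanishes at `s = 0`, so integrating
from there shows that it is modular too (`ThetaTransforms.completedFalseTheta_moebius`).

Now let `τ₁ = γ τ₀` with `γ = (a, b; c, d)`. As a function of `w`, with `s` a square root of `-i(w -
τ₁)`, the completed series at `τ₁` is an antiderivative of the Eichler integrand
(`hasDerivAt_truncCompleted`). When `w` tends to `i∞`, erf tends to sgn and the false theta function
at `τ₁` appears. When `w` tends to the cusp `a/c`, the point `γ⁻¹ w` tends to `i∞`, and modularity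
turns the limit into the false theta function at `τ₀`. The fundamental theorem of calculus along the
path gives `ThetaTransforms.falseTheta`. Any finite set of terms may be left out of the integral;
each then contributes its erf value at the cusp, which is the sum `∑**`.

The multiplier is found separately (`thetaTransforms_etaMultiplier`): a Euclidean algorithm on the
bottom row of `γ`, with odd lower left entries throughout, reduces everything to Jacobi reciprocity
and congruences modulo 8. Square roots are always identified by the sign of their real part, read
off from sectors of the plane. -/

theorem hasDerivAt_cerf (x₀ : ℂ) :
    HasDerivAt cerf (2 / (Real.sqrt Real.pi : ℂ) * Complex.exp (-x₀ ^ 2)) x₀ := by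
  unfold cerf
  refine HasDerivAt.const_mul _ ?_
  set R : ℝ := ‖x₀‖ + 1 with hR
  have hcont : ∀ x : ℂ, Continuous fun s : ℝ => x * Complex.exp (-((s : ℂ) * x) ^ 2) := by
    intro x; fun_prop
  have hcont' : ∀ x : ℂ, Continuous fun s : ℝ =>
      (1 - 2 * (s : ℂ) ^ 2 * x ^ 2) * Complex.exp (-((s : ℂ) * x) ^ 2) := by
    intro x; fun_prop
  have key := (intervalIntegral.hasDerivAt_integral_of_dominated_loc_of_deriv_le (𝕜 := ℂ)
    (μ := volume) (a := 0) (b := 1) (x₀ := x₀)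
    (F := fun x s => x * Complex.exp (-((s : ℂ) * x) ^ 2))
    (F' := fun x s => (1 - 2 * (s : ℂ) ^ 2 * x ^ 2) * Complex.exp (-((s : ℂ) * x) ^ 2))
    (s := Metric.ball x₀ 1) (bound := fun _ => (1 + 2 * R ^ 2) * Real.exp (R ^ 2))
    (Metric.ball_mem_nhds _ one_pos)
    (Eventually.of_forall fun x => (hcont x).aestronglyMeasurable)
    ((hcont x₀).intervalIntegrable _ _) (hcont' x₀).aestronglyMeasurable
    (Eventually.of_forall ?_) (by simp) (Eventually.of_forall ?_)).2
  -- The `x`-derivative of the integrand is also the `s`-derivative of `s exp(-(s x₀)²)`.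
  · have hFTC : ∫ s in (0 : ℝ)..1,
        (1 - 2 * (s : ℂ) ^ 2 * x₀ ^ 2) * Complex.exp (-((s : ℂ) * x₀) ^ 2) =
        Complex.exp (-x₀ ^ 2) := by
      rw [intervalIntegral.integral_eq_sub_of_hasDerivAt
        (f := fun s : ℝ => (s : ℂ) * Complex.exp (-((s : ℂ) * x₀) ^ 2))]
      · simp
      · intro s _
        have h1 : HasDerivAt (fun s : ℝ => (s : ℂ)) 1 s := Complex.ofRealCLM.hasDerivAt
        have h2 := h1.mul (((h1.mul_const x₀).pow 2).neg.cexp)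
        refine h2.congr_deriv ?_
        simp only [Pi.neg_apply, Pi.pow_apply]
        push_cast
        ring
      · exact (hcont' x₀).intervalIntegrable _ _
    rw [hFTC] at key
    exact key
  · intro s hs x hx
    rw [Set.uIoc_of_le zero_le_one] at hs
    have hxR : ‖x‖ ≤ R := by
      have := norm_sub_norm_le x x₀
      rw [mem_ball_iff_norm] at hx
      linarith
    have hs2 : ‖(s : ℂ)‖ ≤ 1 := by
      rw [Complex.norm_real, Real.norm_eq_abs, abs_of_pos hs.1]; exact hs.2
    have hsx : ‖(s : ℂ) * x‖ ^ 2 ≤ R ^ 2 := by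
      gcongr
      rw [norm_mul]
      calc _ ≤ 1 * ‖x‖ := by gcongr
        _ ≤ R := by linarith
    rw [norm_mul]
    gcongr
    · calc ‖1 - 2 * (s : ℂ) ^ 2 * x ^ 2‖ = ‖1 - 2 * ((s : ℂ) * x) ^ 2‖ := by ring_nf
        _ ≤ ‖(1 : ℂ)‖ + ‖2 * ((s : ℂ) * x) ^ 2‖ := norm_sub_le _ _
        _ = 1 + 2 * ‖(s : ℂ) * x‖ ^ 2 := by simp
        _ ≤ _ := by linarith
    · rw [Complex.norm_exp]
      gcongr
      calc _ ≤ ‖-((s : ℂ) * x) ^ 2‖ := Complex.re_le_norm _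
        _ = ‖(s : ℂ) * x‖ ^ 2 := by rw [norm_neg, norm_pow]
        _ ≤ _ := hsx
  · intro s _ x _
    have h2 := (hasDerivAt_id x).mul ((((hasDerivAt_id x).const_mul (s : ℂ)).pow 2).neg.cexp)
    refine h2.congr_deriv ?_
    simp only [Pi.neg_apply, Pi.pow_apply, id]
    push_cast
    ring

theorem cerf_zero : cerf 0 = 0 := by simp [cerf]

theorem cerf_neg (x : ℂ) : cerf (-x) = -cerf x := by
  simp only [cerf, mul_neg, even_two.neg_pow, neg_mul]
  rw [intervalIntegral.integral_neg, mul_neg]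

theorem continuous_cerf : Continuous cerf :=
  continuous_iff_continuousAt.2 fun x => (hasDerivAt_cerf x).continuousAt

theorem two_div_sqrt_pi_le : 2 / √Real.pi ≤ 2 := by
  apply div_le_self (by norm_num)
  rw [Real.one_le_sqrt]
  linarith [Real.pi_gt_three]

/-- A crude bound, valid in all directions: it makes the completed series converge even where erf
grows. -/
theorem norm_cerf_le (x : ℂ) : ‖cerf x‖ ≤ 2 * ‖x‖ * Real.exp (max 0 (-(x ^ 2).re)) := by
  unfold cerf
  rw [norm_mul, mul_assoc]
  gcongr
  · rw [norm_div, Complex.norm_real, Real.norm_of_nonneg (Real.sqrt_nonneg _)]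
    simpa using two_div_sqrt_pi_le
  · have := intervalIntegral.norm_integral_le_of_norm_le_const (a := (0 : ℝ)) (b := 1)
      (C := ‖x‖ * Real.exp (max 0 (-(x ^ 2).re)))
      (f := fun s : ℝ => x * Complex.exp (-((s : ℂ) * x) ^ 2)) ?_
    · simpa using this
    · intro s hs
      rw [Set.uIoc_of_le zero_le_one] at hs
      rw [norm_mul, Complex.norm_exp]
      gcongr
      have h1 : (-((s : ℂ) * x) ^ 2).re = s ^ 2 * (-(x ^ 2).re) := by
        rw [mul_pow, ← Complex.ofReal_pow, Complex.neg_re, Complex.re_ofReal_mul]; ring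
      rw [h1]
      have h2 : s ^ 2 ≤ 1 := by nlinarith [hs.1, hs.2]
      rcases le_total 0 (-(x ^ 2).re) with h | h
      · exact le_max_of_le_right (by nlinarith)
      · exact le_max_of_le_left (by nlinarith [sq_nonneg s])

theorem cerf_add_ofReal_sub (x : ℂ) (T : ℝ) :
    cerf (x + T) - cerf x =
      ∫ t in (0 : ℝ)..T, 2 / (Real.sqrt Real.pi : ℂ) * Complex.exp (-(x + t) ^ 2) := by
  rw [intervalIntegral.integral_eq_sub_of_hasDerivAt (f := fun t : ℝ => cerf (x + t))]
  · simp
  · intro t _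
    have h1 : HasDerivAt (fun t : ℝ => x + (t : ℂ)) 1 t :=
      (Complex.ofRealCLM.hasDerivAt (x := t)).const_add x
    have h2 := (hasDerivAt_cerf (x + t)).comp t h1
    rw [mul_one] at h2
    exact h2
  · apply Continuous.intervalIntegrable
    fun_prop

theorem tendsto_cerf_ofReal : Tendsto (fun T : ℝ => cerf T) atTop (𝓝 1) := by
  have h1 : ∀ T : ℝ, cerf T = ∫ t in (0 : ℝ)..T,
      ((2 / √Real.pi * Real.exp (-1 * t ^ 2) : ℝ) : ℂ) := by
    intro T
    have := cerf_add_ofReal_sub 0 T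
    rw [cerf_zero, sub_zero, zero_add] at this
    rw [this]
    congr 1
    ext t
    push_cast
    simp
  simp_rw [h1]
  have hint : Integrable fun t : ℝ => 2 / √Real.pi * Real.exp (-1 * t ^ 2) :=
    (integrable_exp_neg_mul_sq one_pos).const_mul _
  have h2 := intervalIntegral_tendsto_integral_Ioi 0
    (hint.ofReal (𝕜 := ℂ)).integrableOn tendsto_id
  refine h2.trans (le_of_eq (congrArg _ ?_))
  rw [integral_ofReal, integral_const_mul, integral_gaussian_Ioi]
  have : √Real.pi ≠ 0 := by positivity
  rw [div_one, div_mul_div_comm, mul_comm, div_self (by positivity)]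
  simp

/-- On the segment from `T` to `x + T` the derivative of erf is at most `2 exp(x.im² - T)` once `T ≥
1`, so the limit is the same as along the real axis. -/
theorem tendsto_cerf_add_ofReal {x : ℂ} (hx : 0 ≤ x.re) :
    Tendsto (fun T : ℝ => cerf (x + T)) atTop (𝓝 1) := by
  have hdiff : Tendsto (fun T : ℝ => cerf (x + T) - cerf T) atTop (𝓝 0) := by
    apply squeeze_zero_norm' (a := fun T : ℝ => 2 * Real.exp (x.im ^ 2) * ‖x‖ * Real.exp (-T))
    · filter_upwards [eventually_ge_atTop 1] with T hT
      have := (convex_segment (T : ℂ) (x + T)).norm_image_sub_le_of_norm_hasDerivWithin_le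
        (f := cerf) (f' := fun x₀ => 2 / (Real.sqrt Real.pi : ℂ) * Complex.exp (-x₀ ^ 2))
        (C := 2 * Real.exp (x.im ^ 2 - T))
        (fun y _ => (hasDerivAt_cerf y).hasDerivWithinAt) ?_ (left_mem_segment ℝ _ _)
        (right_mem_segment ℝ _ _)
      · rw [add_sub_cancel_right] at this
        refine this.trans (le_of_eq ?_)
        rw [sub_eq_add_neg, Real.exp_add]; ring
      · intro y hy
        rw [segment_eq_image'] at hy
        obtain ⟨p, hp, rfl⟩ := hy
        rw [norm_mul, norm_div, Complex.norm_real, Real.norm_of_nonneg (Real.sqrt_nonneg _),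
          Complex.norm_exp]
        gcongr
        · simpa using two_div_sqrt_pi_le
        · simp only [Complex.neg_re, sq, Complex.mul_re, Complex.add_re, Complex.ofReal_re,
            Complex.add_im, Complex.ofReal_im, Complex.smul_re, Complex.smul_im, smul_eq_mul,
            add_sub_cancel_right, zero_add]
          have h1 : p * p ≤ 1 := by nlinarith [hp.1, hp.2]
          have h2 : T * T ≤ (T + p * x.re) * (T + p * x.re) := by
            have := mul_nonneg hp.1 hx
            nlinarith
          nlinarith [mul_self_nonneg x.im]
    · have := (Real.tendsto_exp_neg_atTop_nhds_zero).const_mul (2 * Real.exp (x.im ^ 2) * ‖x‖)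
      simpa using this
  simpa using hdiff.add tendsto_cerf_ofReal

/-- Integrate along the horizontal ray `x + t`: since `Re x ≥ 0`, the cross term `2 x t` only helps,
and the remaining factor `exp(-t²)` has normalised integral 1. -/
theorem norm_one_sub_cerf_le {x : ℂ} (hx : 0 ≤ x.re) :
    ‖1 - cerf x‖ ≤ Real.exp (-(x ^ 2).re) := by
  have hlim : Tendsto (fun T : ℝ => ‖cerf (x + T) - cerf x‖) atTop (𝓝 ‖1 - cerf x‖) :=
    ((tendsto_cerf_add_ofReal hx).sub_const _).norm
  refine le_of_tendsto hlim ?_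
  filter_upwards [eventually_ge_atTop 0] with T hT
  rw [cerf_add_ofReal_sub]
  have hint : Integrable fun t : ℝ => 2 / √Real.pi * Real.exp (-(x ^ 2).re) *
      Real.exp (-1 * t ^ 2) := (integrable_exp_neg_mul_sq one_pos).const_mul _
  calc _ ≤ ∫ t in (0 : ℝ)..T, 2 / √Real.pi * Real.exp (-(x ^ 2).re) * Real.exp (-1 * t ^ 2) := by
        refine intervalIntegral.norm_integral_le_of_norm_le hT (Eventually.of_forall ?_)
          hint.intervalIntegrable
        intro t ht
        rw [norm_mul, norm_div, Complex.norm_real, Real.norm_of_nonneg (Real.sqrt_nonneg _),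
          Complex.norm_exp, mul_assoc, ← Real.exp_add]
        simp only [Complex.norm_ofNat]
        gcongr
        simp only [Complex.neg_re, sq, Complex.mul_re, Complex.add_re, Complex.ofReal_re,
          Complex.add_im, Complex.ofReal_im]
        nlinarith [mul_nonneg ht.1.le hx]
    _ ≤ ∫ t in Set.Ioi (0 : ℝ), 2 / √Real.pi * Real.exp (-(x ^ 2).re) *
          Real.exp (-1 * t ^ 2) := by
        rw [intervalIntegral.integral_of_le hT]
        refine setIntegral_mono_set hint.integrableOn (Eventually.of_forall fun t => by
          simp only [Pi.zero_apply]; positivity) (Eventually.of_forall Set.Ioc_subset_Ioi_self)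
    _ = Real.exp (-(x ^ 2).re) := by
        rw [integral_const_mul, integral_gaussian_Ioi, div_one]
        field_simp

theorem norm_cerf_le_two {x : ℂ} (hx : 0 ≤ (x ^ 2).re) : ‖cerf x‖ ≤ 2 := by
  wlog h : 0 ≤ x.re generalizing x
  · have := this (x := -x) (by simpa using hx) (by simp; linarith)
    rwa [cerf_neg, norm_neg] at this
  have h1 := norm_one_sub_cerf_le h
  have h2 : Real.exp (-(x ^ 2).re) ≤ 1 := Real.exp_le_one_iff.2 (by linarith)
  have h3 := norm_sub_norm_le (cerf x) 1
  rw [norm_sub_rev] at h3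
  rw [norm_one] at h3
  linarith

/-- If `Re s > 0` and `Re s²` tends to infinity, then `erf (x s)` tends to `sgn x`. -/
theorem tendsto_cerf_mul {ι : Type*} {l : Filter ι} {s : ι → ℂ} (hs : ∀ᶠ i in l, 0 < (s i).re)
    (hs2 : Tendsto (fun i => (s i ^ 2).re) l atTop) (x : ℝ) :
    Tendsto (fun i => cerf (x * s i)) l (𝓝 (Real.sign x : ℂ)) := by
  have pos : ∀ x : ℝ, 0 < x → Tendsto (fun i => cerf (x * s i)) l (𝓝 1) := by
    intro x hx
    have : Tendsto (fun i => 1 - cerf (x * s i)) l (𝓝 0) := by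
      apply squeeze_zero_norm' (a := fun i => Real.exp (-(x ^ 2 * (s i ^ 2).re)))
      · filter_upwards [hs] with i hi
        have := norm_one_sub_cerf_le (x := x * s i) (by rw [Complex.re_ofReal_mul]; positivity)
        rwa [mul_pow, ← Complex.ofReal_pow, Complex.re_ofReal_mul] at this
      · exact Real.tendsto_exp_neg_atTop_nhds_zero.comp
          (hs2.const_mul_atTop (by positivity))
    simpa using this.const_sub 1
  rcases lt_trichotomy x 0 with h | rfl | h
  · have := (pos (-x) (by linarith)).neg
    rw [Real.sign_of_neg h]
    simpa [cerf_neg] using this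
  · simp [cerf_zero, tendsto_const_nhds]
  · rw [Real.sign_of_pos h]
    simpa using pos x h

/-! ### Complex square roots -/

theorem csqrt_sq (w : ℂ) : csqrt w ^ 2 = w := by
  unfold csqrt
  rw [← Complex.cpow_nat_mul]
  simp

/-- The only test for the principal branch used below: the square is right and the real part is
positive. -/
theorem csqrt_eq_of_sq {s w : ℂ} (h : s ^ 2 = w) (hs : 0 < s.re) : csqrt w = s := by
  rw [← h, csqrt, one_div, Complex.sq_cpow_two_inv hs]

theorem csqrt_re_pos {w : ℂ} (hw : w ∈ Complex.slitPlane) : 0 < (csqrt w).re := by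
  have hw0 : w ≠ 0 := Complex.slitPlane_ne_zero hw
  rw [csqrt, Complex.cpow_def_of_ne_zero hw0, Complex.exp_re]
  refine mul_pos (Real.exp_pos _) (Real.cos_pos_of_mem_Ioo ?_)
  have h1 : (Complex.log w * (1 / 2)).im = w.arg / 2 := by
    rw [show (1 / 2 : ℂ) = ((1 / 2 : ℝ) : ℂ) by push_cast; rfl, Complex.im_mul_ofReal,
      Complex.log_im]
    ring
  rw [h1]
  have h2 := Complex.neg_pi_lt_arg w
  have h3 := (Complex.arg_le_pi w).lt_of_ne (Complex.mem_slitPlane_iff_arg.1 hw).1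
  constructor <;> linarith

theorem csqrt_ne_zero {w : ℂ} (hw : w ≠ 0) : csqrt w ≠ 0 := by
  intro h
  apply hw
  rw [← csqrt_sq w, h]
  simp

theorem csqrt_im_pos {w : ℂ} (hw : 0 < w.im) : 0 < (csqrt w).im := by
  have h1 := csqrt_re_pos (Complex.mem_slitPlane_iff.2 (Or.inr hw.ne'))
  have h2 := congrArg Complex.im (csqrt_sq w)
  rw [sq, Complex.mul_im] at h2
  by_contra! h
  nlinarith

theorem abs_im_csqrt_lt {w : ℂ} (hw : 0 < w.re) : |(csqrt w).im| < (csqrt w).re := by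
  have h1 := csqrt_re_pos (Complex.mem_slitPlane_iff.2 (Or.inl hw))
  have h2 := congrArg Complex.re (csqrt_sq w)
  rw [sq, Complex.mul_re] at h2
  exact abs_lt_of_sq_lt_sq (by nlinarith) h1.le

theorem hasDerivAt_csqrt {w : ℂ} (hw : w ∈ Complex.slitPlane) :
    HasDerivAt csqrt (1 / (2 * csqrt w)) w := by
  have h := (hasDerivAt_id w).cpow_const (c := 1 / 2) hw
  refine h.congr_deriv ?_
  have hw0 : w ≠ 0 := Complex.slitPlane_ne_zero hw
  simp only [id, mul_one]
  rw [show (1 / 2 - 1 : ℂ) = -(1 / 2) by norm_num, Complex.cpow_neg]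
  unfold csqrt
  field_simp

theorem exp_pi_div_four : Complex.exp (Real.pi * Complex.I / 4) =
    (1 + Complex.I) / (√2 : ℝ) := by
  have h2 : ((√2 : ℝ) : ℂ) ^ 2 = 2 := by
    rw [← Complex.ofReal_pow, Real.sq_sqrt (by norm_num)]; norm_num
  have h3 : ((√2 : ℝ) : ℂ) ≠ 0 := by
    intro h; rw [h] at h2; norm_num at h2
  rw [show (Real.pi * Complex.I / 4 : ℂ) = ((Real.pi / 4 : ℝ) : ℂ) * Complex.I by push_cast; ring,
    Complex.exp_mul_I, ← Complex.ofReal_cos, ← Complex.ofReal_sin, Real.cos_pi_div_four,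
    Real.sin_pi_div_four]
  push_cast
  field_simp
  rw [h2]

/-- The primitive eighth root of unity `exp (π i / 4)`. -/
def zetaEight : ℂ := Complex.exp (Real.pi * Complex.I / 4)

theorem zetaEight_ne_zero : zetaEight ≠ 0 := Complex.exp_ne_zero _

theorem zetaEight_sq : zetaEight ^ 2 = Complex.I := by
  rw [zetaEight, ← Complex.exp_nat_mul]
  rw [show ((2 : ℕ) : ℂ) * (Real.pi * Complex.I / 4) = Real.pi / 2 * Complex.I by push_cast; ring,
    Complex.exp_pi_div_two_mul_I]

theorem zetaEight_pow_four : zetaEight ^ 4 = -1 := by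
  rw [show (4 : ℕ) = 2 * 2 by norm_num, pow_mul, zetaEight_sq, Complex.I_sq]

theorem zetaEight_zpow_congr {m n : ℤ} (h : (8 : ℤ) ∣ m - n) : zetaEight ^ m = zetaEight ^ n := by
  obtain ⟨k, hk⟩ := h
  rw [show m = n + 8 * k by linarith, zpow_add₀ zetaEight_ne_zero, zpow_mul]
  have : zetaEight ^ (8 : ℤ) = 1 := by
    rw [show (8 : ℤ) = ((4 * 2 : ℕ) : ℤ) by norm_num, zpow_natCast, pow_mul, zetaEight_pow_four]
    norm_num
  rw [this, one_zpow, mul_one]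

theorem exp_eq_zetaEight_zpow (n : ℤ) :
    Complex.exp (Real.pi * Complex.I / 4 * n) = zetaEight ^ n := by
  rw [zetaEight, ← Complex.exp_int_mul, mul_comm]

/-- Arguments add up: `x` has argument in `(0, π/2)`, `ζ₈⁻¹` shifts this to `(-π/4, π/4)`, and `y`
contributes another angle in `(-π/4, π/4)`. -/
theorem zetaEight_mul_mul_re_pos {x y : ℂ} (hx : 0 < x.re) (hx' : 0 < x.im)
    (hy : |y.im| < y.re) : 0 < (zetaEight⁻¹ * x * y).re := by
  have h : zetaEight⁻¹ = ((√2 / 2 : ℝ) : ℂ) * (1 - Complex.I) := by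
    have h2 : ((√2 : ℝ) : ℂ) ^ 2 = 2 := by
      rw [← Complex.ofReal_pow, Real.sq_sqrt (by norm_num)]; norm_num
    have h3 : ((√2 : ℝ) : ℂ) ≠ 0 := by
      intro h; rw [h] at h2; norm_num at h2
    refine inv_eq_of_mul_eq_one_right ?_
    rw [zetaEight, exp_pi_div_four]
    push_cast
    field_simp
    linear_combination -Complex.I_sq
  rw [h, mul_assoc, mul_assoc, Complex.re_ofReal_mul]
  refine mul_pos (by positivity) ?_
  obtain ⟨h1, h2⟩ := abs_lt.1 hy
  simp only [Complex.mul_re, Complex.mul_im, Complex.sub_re, Complex.sub_im, Complex.one_re,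
    Complex.one_im, Complex.I_re, Complex.I_im]
  nlinarith [mul_pos hx (by linarith : 0 < y.re - y.im), mul_pos hx' (by linarith : 0 < y.re - y.im),
    mul_pos hx (by linarith : 0 < y.re + y.im), mul_pos hx' (by linarith : 0 < y.re + y.im)]

theorem csqrt_mul_csqrt_of_mul_eq_neg {u τ J : ℂ} (hu : 0 < u.im) (hτ : 0 < τ.im)
    (h : u * τ = -J) : csqrt u * csqrt (-Complex.I * τ) = zetaEight * csqrt J := by
  have hre : 0 < (-Complex.I * τ).re := by simpa using hτ
  have := zetaEight_mul_mul_re_pos (csqrt_re_pos (Complex.mem_slitPlane_iff.2 (Or.inr hu.ne')))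
    (csqrt_im_pos hu) (abs_im_csqrt_lt hre)
  rw [csqrt_eq_of_sq (w := J) _ this, mul_assoc, mul_inv_cancel_left₀ zetaEight_ne_zero]
  rw [mul_pow, mul_pow, csqrt_sq, csqrt_sq, inv_pow, zetaEight_sq, Complex.inv_I]
  linear_combination -h + u * τ * Complex.I_sq

theorem csqrt_mul_csqrt_of_mul_eq {u τ J : ℂ} (hu : 0 < u.im) (hτ : 0 < τ.im) (hJ : 0 < J.im)
    (h : u * τ = J) : csqrt u * csqrt (-Complex.I * τ) = zetaEight⁻¹ * csqrt J := by
  have hre : 0 < (-Complex.I * τ).re := by simpa using hτ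
  have h1 := zetaEight_mul_mul_re_pos (csqrt_re_pos (Complex.mem_slitPlane_iff.2 (Or.inr hu.ne')))
    (csqrt_im_pos hu) (abs_im_csqrt_lt hre)
  set s := zetaEight * csqrt u * csqrt (-Complex.I * τ) with hs
  have hs1 : s = Complex.I * (zetaEight⁻¹ * csqrt u * csqrt (-Complex.I * τ)) := by
    rw [hs, ← zetaEight_sq]
    field_simp [zetaEight_ne_zero]
  have hs2 : s ^ 2 = J := by
    rw [hs, mul_pow, mul_pow, csqrt_sq, csqrt_sq, zetaEight_sq]
    linear_combination h - u * τ * Complex.I_sq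
  have hs3 : 0 < s.im := by rw [hs1]; simpa using h1
  -- The sector estimate only puts `s` in the upper half-plane; that `Im s² = Im J` is positive then
  -- forces `Re s > 0`.
  have hs4 : 0 < s.re := by
    rw [← hs2, sq, Complex.mul_im] at hJ
    by_contra! h
    nlinarith
  rw [csqrt_eq_of_sq hs2 hs4, hs]
  field_simp [zetaEight_ne_zero]

/-! ### The odd Jacobi theta function -/

/-- The odd Jacobi theta function `∑ (-1)^n exp (π i m² τ + 2 π i m z)`, with `m = n + 1/2`. -/
def oddTheta (z τ : ℂ) : ℂ :=
  Complex.exp (Real.pi * Complex.I * (τ / 4 + z)) * jacobiTheta₂ (z + τ / 2 + 1 / 2) τ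

def oddThetaTerm (z τ : ℂ) (n : ℤ) : ℂ :=
  (-1) ^ n * Complex.exp (Real.pi * Complex.I * (half n : ℂ) ^ 2 * τ +
    2 * Real.pi * Complex.I * (half n : ℂ) * z)

theorem neg_one_zpow_eq_exp (n : ℤ) : (-1 : ℂ) ^ n = Complex.exp (Real.pi * Complex.I * n) := by
  rw [← Complex.exp_pi_mul_I, ← Complex.exp_int_mul, mul_comm]

theorem half_cast (n : ℤ) : (half n : ℂ) = n + 1 / 2 := by
  simp [half]

theorem oddThetaTerm_eq (z τ : ℂ) (n : ℤ) : oddThetaTerm z τ n =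
    Complex.exp (Real.pi * Complex.I * (τ / 4 + z)) *
      jacobiTheta₂_term n (z + τ / 2 + 1 / 2) τ := by
  rw [oddThetaTerm, jacobiTheta₂_term, neg_one_zpow_eq_exp, ← Complex.exp_add, ← Complex.exp_add,
    half_cast]
  congr 1
  ring

theorem hasSum_oddTheta (z : ℂ) {τ : ℂ} (hτ : 0 < τ.im) :
    HasSum (oddThetaTerm z τ) (oddTheta z τ) := by
  simp_rw [funext (oddThetaTerm_eq z τ)]
  exact (hasSum_jacobiTheta₂_term _ hτ).mul_left _

theorem half_reflect (n : ℤ) : half (-1 - n) = -half n := by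
  simp only [half]; push_cast; ring

theorem oddTheta_neg (z : ℂ) {τ : ℂ} (hτ : 0 < τ.im) : oddTheta (-z) τ = -oddTheta z τ := by
  -- The reflection `n ↦ -1 - n` is `m ↦ -m` and reverses the sign `(-1)^n`.
  have h1 := (Equiv.subLeft (-1 : ℤ)).hasSum_iff.2 (hasSum_oddTheta (-z) hτ)
  refine h1.unique ?_
  convert! (hasSum_oddTheta z hτ).neg using 2 with n
  simp only [Function.comp, Equiv.subLeft_apply, oddThetaTerm, half_reflect]
  rw [zpow_sub₀ (by norm_num)]
  have : ((-1 : ℂ) ^ n)⁻¹ = (-1) ^ n := by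
    rw [← inv_zpow]; norm_num
  rw [div_eq_mul_inv, this]
  push_cast
  rw [zpow_neg_one]
  ring_nf

theorem oddTheta_add_one (z τ : ℂ) (hτ : 0 < τ.im) :
    oddTheta z (τ + 1) = zetaEight * oddTheta z τ := by
  refine (hasSum_oddTheta z (by simpa using hτ)).unique ?_
  convert! (hasSum_oddTheta z hτ).mul_left zetaEight using 2 with n
  rw [oddThetaTerm, oddThetaTerm, zetaEight, mul_left_comm, ← Complex.exp_add]
  -- `m² = n(n + 1) + 1/4` with `n(n + 1)` even, so `exp(π i m²) = ζ₈` for every `m`.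
  obtain ⟨k, hk⟩ := Int.even_mul_succ_self n
  congr 1
  rw [half_cast, Complex.exp_eq_exp_iff_exists_int]
  refine ⟨k, ?_⟩
  have hk' : (n : ℂ) * (n + 1) = k + k := by exact_mod_cast hk
  linear_combination Real.pi * Complex.I * hk'

theorem oddTheta_add_int (z τ : ℂ) (hτ : 0 < τ.im) (n : ℤ) :
    oddTheta z (τ + n) = zetaEight ^ n * oddTheta z τ := by
  induction n with
  | zero => simp
  | succ n ih =>
    rw [zpow_add₀ zetaEight_ne_zero, zpow_one]
    push_cast at ih ⊢
    rw [← add_assoc, oddTheta_add_one _ _ (by simpa using hτ), ih]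
    ring
  | pred n ih =>
    have h := oddTheta_add_one z (τ + ((-(n : ℤ) - 1 : ℤ) : ℂ)) (by simpa using hτ)
    rw [add_assoc, show (((-(n : ℤ) - 1 : ℤ) : ℂ) + 1) = ((-(n : ℤ) : ℤ) : ℂ) by push_cast; ring,
      ih] at h
    rw [zpow_sub₀ zetaEight_ne_zero, zpow_one, div_eq_mul_inv, mul_right_comm, h]
    field_simp [zetaEight_ne_zero]

theorem oddTheta_S (z : ℂ) {τ : ℂ} (hτ : 0 < τ.im) :
    oddTheta (z / τ) (-1 / τ) = -Complex.I * csqrt (-Complex.I * τ) *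
      Complex.exp (Real.pi * Complex.I * z ^ 2 / τ) * oddTheta z τ := by
  have hτ0 : τ ≠ 0 := by rintro rfl; simp at hτ
  have hs : csqrt (-Complex.I * τ) ≠ 0 := csqrt_ne_zero (by simp [hτ0])
  have h1 := jacobiTheta₂_functional_equation (z + τ / 2 + 1 / 2) τ
  -- The shifted arguments on the two sides differ by the quasi-period `-1/τ`.
  have h2 := jacobiTheta₂_add_left' (z / τ - 1 / (2 * τ) + 1 / 2 + 1 / τ) (-1 / τ)
  rw [show z / τ - 1 / (2 * τ) + 1 / 2 + 1 / τ + -1 / τ = z / τ + (-1 / τ) / 2 + 1 / 2 by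
    field_simp; ring] at h2
  rw [show (z + τ / 2 + 1 / 2) / τ = z / τ - 1 / (2 * τ) + 1 / 2 + 1 / τ by
    field_simp; ring] at h1
  rw [oddTheta, oddTheta, h2, h1]
  change _ = -Complex.I * csqrt (-Complex.I * τ) * _ *
    (_ * (1 / csqrt (-Complex.I * τ) * _ * _))
  have h3 : -Complex.I = Complex.exp (-(Real.pi * Complex.I / 2)) := by
    rw [Complex.exp_neg, show (Real.pi * Complex.I / 2 : ℂ) = Real.pi / 2 * Complex.I by ring,
      Complex.exp_pi_div_two_mul_I, Complex.inv_I]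
  have h4 : ∀ A B C D E F : ℂ, ∀ s ≠ (0 : ℂ), A * B = D * E * F * C →
      ∀ x, A * (B * x) = D * s * E * (F * (1 / s * C * x)) := by
    intro A B C D E F s hs h x
    field_simp
    linear_combination x * h
  refine h4 _ _ _ _ _ _ _ hs ?_ _
  rw [h3]
  simp only [← Complex.exp_add]
  rw [Complex.exp_eq_exp_iff_exists_int]
  refine ⟨0, ?_⟩
  field_simp
  ring

/-! ### The transformation law of the odd theta function under `SL₂(ℤ)` -/

/-- The transformation law `ϑ(z/(cτ+d); (aτ+b)/(cτ+d)) = v (cτ+d)^{1/2} e^{πicz²/(cτ+d)} ϑ(z; τ)`. -/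
def ThetaTransforms (a b c d : ℤ) (v : ℂ) : Prop :=
  ∀ z τ : ℂ, 0 < τ.im →
    oddTheta (z / (c * τ + d)) ((a * τ + b) / (c * τ + d)) =
      v * csqrt (c * τ + d) * Complex.exp (Real.pi * Complex.I * c * z ^ 2 / (c * τ + d)) *
        oddTheta z τ

/-- Right multiplication of the matrix by `T^n`, where `T τ = τ + 1`. -/
theorem ThetaTransforms.mul_translation {a b c d : ℤ} {v : ℂ} (h : ThetaTransforms a b c d v)
    (n : ℤ) : ThetaTransforms a (a * n + b) c (c * n + d) (v * zetaEight ^ n) := by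
  intro z τ hτ
  have h1 := h z (τ + n) (by simpa using hτ)
  rw [oddTheta_add_int _ _ hτ] at h1
  push_cast
  rw [show (c : ℂ) * τ + (c * n + d) = c * (τ + n) + d by ring,
    show (a : ℂ) * τ + (a * n + b) = a * (τ + n) + b by ring, h1]
  ring

theorem im_int_mul_add {c : ℤ} (hc : 0 < c) (d : ℤ) {τ : ℂ} (hτ : 0 < τ.im) :
    0 < ((c : ℂ) * τ + d).im := by
  have : (0 : ℝ) < c := by exact_mod_cast hc
  simp only [Complex.add_im, Complex.mul_im, Complex.intCast_re, Complex.intCast_im, zero_mul,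
    add_zero]
  positivity

theorem im_neg_one_div {τ : ℂ} (hτ : 0 < τ.im) : 0 < (-1 / τ).im := by
  have hτ0 : τ ≠ 0 := by rintro rfl; simp at hτ
  rw [neg_div, one_div, Complex.neg_im, Complex.inv_im, neg_div, neg_neg]
  exact div_pos hτ (Complex.normSq_pos.2 hτ0)

/-- The matrix is `T^a S`, with `S τ = -1/τ`. The exponent `-3` combines the factor `-i = ζ₈⁻²` of
the inversion formula with `√(-iτ) = ζ₈⁻¹ √τ`. -/
theorem thetaTransforms_inversion (a : ℤ) :
    ThetaTransforms a (-1) 1 0 (zetaEight ^ (a - 3)) := by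
  intro z τ hτ
  have hτ0 : τ ≠ 0 := by rintro rfl; simp at hτ
  have h1 := oddTheta_add_int (z / τ) (-1 / τ) (im_neg_one_div hτ) a
  rw [oddTheta_S z hτ] at h1
  push_cast
  rw [one_mul, add_zero, show (a * τ + -1) / τ = -1 / τ + a by field_simp; ring, h1]
  have h3 : csqrt (-Complex.I * τ) = zetaEight⁻¹ * csqrt τ := by
    have hx := zetaEight_mul_mul_re_pos (csqrt_re_pos (Complex.mem_slitPlane_iff.2 (Or.inr hτ.ne')))
      (csqrt_im_pos hτ) (y := 1) (by simp)
    rw [mul_one] at hx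
    refine csqrt_eq_of_sq ?_ hx
    rw [mul_pow, csqrt_sq, inv_pow, zetaEight_sq, Complex.inv_I]
  have h8 : zetaEight ^ (a - 3) = zetaEight ^ a * (-Complex.I * zetaEight⁻¹) := by
    rw [zpow_sub₀ zetaEight_ne_zero, div_eq_mul_inv]
    congr 1
    refine inv_eq_of_mul_eq_one_right ?_
    rw [show (3 : ℤ) = ((3 : ℕ) : ℤ) by norm_num, zpow_natCast, ← zetaEight_sq]
    field_simp [zetaEight_ne_zero]
    linear_combination -zetaEight_pow_four
  rw [h3, h8, mul_one]
  ring

/-- Here `(b, -a; d, -c) S = -(a, b; c, d)`. The sign of the matrix is absorbed by the oddness of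
the theta function in `z`, and `ζ₈³ = (-1)(-i) ζ₈` collects this sign, the factor of `S` and the
comparison of square roots. -/
theorem ThetaTransforms.of_mul_S_of_pos {a b c d : ℤ} {v : ℂ} (hc : 0 < c) (hd : 0 < d)
    (h : ThetaTransforms b (-a) d (-c) v) : ThetaTransforms a b c d (v * zetaEight ^ (3 : ℤ)) := by
  intro z τ hτ
  have hτ0 : τ ≠ 0 := by rintro rfl; simp at hτ
  have hJ := im_int_mul_add hc d hτ
  have hJ0 : (c : ℂ) * τ + d ≠ 0 := by intro h0; rw [h0] at hJ; simp at hJ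
  have h1 := h (-z / τ) (-1 / τ) (im_neg_one_div hτ)
  have hu := im_int_mul_add hd (-c) (im_neg_one_div hτ)
  push_cast at h1 hu
  have hu' : (d : ℂ) * (-1 / τ) + -c = -(c * τ + d) / τ := by field_simp; ring
  rw [hu'] at h1 hu
  have h2 := csqrt_mul_csqrt_of_mul_eq_neg hu hτ (J := c * τ + d) (by field_simp)
  rw [show -z / τ / (-(c * τ + d) / τ) = z / (c * τ + d) by field_simp,
    show (b * (-1 / τ) + -a) / (-(c * τ + d) / τ) = (a * τ + b) / (c * τ + d) by
      field_simp; ring, show -z / τ = -(z / τ) by ring, oddTheta_neg _ (im_neg_one_div hτ),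
      oddTheta_S z hτ] at h1
  rw [h1]
  have he : Complex.exp (Real.pi * Complex.I * d * (-(z / τ)) ^ 2 / (-(c * τ + d) / τ)) *
      Complex.exp (Real.pi * Complex.I * z ^ 2 / τ) =
      Complex.exp (Real.pi * Complex.I * c * z ^ 2 / (c * τ + d)) := by
    rw [← Complex.exp_add]
    congr 1
    generalize hJe : (c : ℂ) * τ + d = J at hJ0
    field_simp
    linear_combination -z ^ 2 * hJe
  have h3 : zetaEight ^ (3 : ℤ) = Complex.I * zetaEight := by
    rw [show (3 : ℤ) = ((3 : ℕ) : ℤ) by norm_num, zpow_natCast, pow_succ, zetaEight_sq]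
  rw [← he, h3]
  linear_combination v * Complex.I *
    Complex.exp (Real.pi * Complex.I * d * (-(z / τ)) ^ 2 / (-(c * τ + d) / τ)) *
      Complex.exp (Real.pi * Complex.I * z ^ 2 / τ) * oddTheta z τ * h2

/-- The counterpart for `d < 0`, where `(-b, a; -d, c) S = (a, b; c, d)` without a sign and with
positive lower left entry `-d`. -/
theorem ThetaTransforms.of_mul_S_of_neg {a b c d : ℤ} {v : ℂ} (hc : 0 < c) (hd : d < 0)
    (h : ThetaTransforms (-b) a (-d) c v) :
    ThetaTransforms a b c d (v * zetaEight ^ (-3 : ℤ)) := by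
  intro z τ hτ
  have hτ0 : τ ≠ 0 := by rintro rfl; simp at hτ
  have hJ := im_int_mul_add hc d hτ
  have hJ0 : (c : ℂ) * τ + d ≠ 0 := by intro h0; rw [h0] at hJ; simp at hJ
  have h1 := h (z / τ) (-1 / τ) (im_neg_one_div hτ)
  have hu := im_int_mul_add (neg_pos.2 hd) c (im_neg_one_div hτ)
  push_cast at h1 hu
  have hu' : -(d : ℂ) * (-1 / τ) + c = (c * τ + d) / τ := by field_simp; ring
  rw [hu'] at h1 hu
  have h2 := csqrt_mul_csqrt_of_mul_eq hu hτ hJ (by field_simp)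
  rw [show z / τ / ((c * τ + d) / τ) = z / (c * τ + d) by field_simp,
    show (-b * (-1 / τ) + a) / ((c * τ + d) / τ) = (a * τ + b) / (c * τ + d) by
      field_simp; ring, oddTheta_S z hτ] at h1
  rw [h1]
  have he : Complex.exp (Real.pi * Complex.I * -d * (z / τ) ^ 2 / ((c * τ + d) / τ)) *
      Complex.exp (Real.pi * Complex.I * z ^ 2 / τ) =
      Complex.exp (Real.pi * Complex.I * c * z ^ 2 / (c * τ + d)) := by
    rw [← Complex.exp_add]
    congr 1
    generalize hJe : (c : ℂ) * τ + d = J at hJ0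
    field_simp
    linear_combination -z ^ 2 * hJe
  have h3 : zetaEight ^ (-3 : ℤ) = -Complex.I * zetaEight⁻¹ := by
    rw [zpow_neg, show (3 : ℤ) = ((3 : ℕ) : ℤ) by norm_num, zpow_natCast, pow_succ, zetaEight_sq,
      mul_inv, Complex.inv_I]
  rw [← he, h3]
  linear_combination -v * Complex.I *
    Complex.exp (Real.pi * Complex.I * -d * (z / τ) ^ 2 / ((c * τ + d) / τ)) *
      Complex.exp (Real.pi * Complex.I * z ^ 2 / τ) * oddTheta z τ * h2

/-! ### The multiplier -/

theorem neg_one_eq_zetaEight : (-1 : ℂ) = zetaEight ^ (4 : ℤ) := by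
  rw [show (4 : ℤ) = ((4 : ℕ) : ℤ) by norm_num, zpow_natCast, zetaEight_pow_four]

/-- The multiplier of the odd theta function for odd positive `c`. -/
def oddMultiplier (a d : ℤ) (c : ℕ) : ℂ :=
  (jacobiSym d c : ℂ) * zetaEight ^ (c * (a + d - 3))

theorem jacobiSym_neg_one_eq {c : ℕ} (hc : Odd c) :
    ((jacobiSym (-1) c : ℤ) : ℂ) = zetaEight ^ (2 * ((c : ℤ) - 1)) := by
  obtain ⟨x, rfl⟩ := hc
  rw [jacobiSym.at_neg_one ⟨x, rfl⟩, ZMod.χ₄_eq_neg_one_pow (by omega)]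
  push_cast
  rw [neg_one_eq_zetaEight, ← zpow_natCast, ← zpow_mul]
  congr 1
  rw [show (2 * x + 1) / 2 = x by omega]
  ring

theorem jacobiSym_reciprocity_eq {c d : ℕ} (hc : Odd c) (hd : Odd d) :
    ((jacobiSym c d : ℤ) : ℂ) =
      zetaEight ^ (((c : ℤ) - 1) * (d - 1)) * (jacobiSym d c : ℤ) := by
  obtain ⟨x, rfl⟩ := hc
  obtain ⟨y, rfl⟩ := hd
  rw [jacobiSym.quadratic_reciprocity ⟨x, rfl⟩ ⟨y, rfl⟩]
  push_cast
  rw [neg_one_eq_zetaEight, ← zpow_natCast, ← zpow_mul]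
  congr 2
  rw [show (2 * x + 1) / 2 = x by omega, show (2 * y + 1) / 2 = y by omega]
  push_cast
  ring

theorem eight_dvd_of_mul_odd {c e : ℤ} (hc : Odd c) (h : (8 : ℤ) ∣ c * e) : (8 : ℤ) ∣ e := by
  refine IsCoprime.dvd_of_dvd_mul_left ?_ h
  have := (Int.isCoprime_two_left.2 hc).pow_left (m := 3)
  norm_num at this
  exact this

theorem odd_sq_eq {c : ℤ} (hc : Odd c) : ∃ k, c ^ 2 = 8 * k + 1 := by
  obtain ⟨k, hk⟩ := Int.eight_dvd_sq_sub_one_of_odd hc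
  exact ⟨k, by linarith⟩

/-- Consistency with the `S`-step. Reciprocity and the symbol of `-1` become powers of `ζ₈`, leaving
a congruence modulo 8 between exponents. It is checked after multiplication by the odd number `c d`,
where `c² ≡ d² ≡ 1 (mod 8)` and the determinant equation apply. -/
theorem oddMultiplier_of_pos {a b : ℤ} {c d : ℕ} (hc : Odd c) (hd : Odd d)
    (hdet : a * d - b * c = 1) :
    oddMultiplier b (-c) d * zetaEight ^ (3 : ℤ) = oddMultiplier a d c := by
  have hcz : Odd (c : ℤ) := by exact_mod_cast hc
  have hdz : Odd (d : ℤ) := by exact_mod_cast hd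
  have hJ : ((jacobiSym (-(c : ℤ)) d : ℤ) : ℂ) = zetaEight ^ (2 * ((d : ℤ) - 1)) *
      (zetaEight ^ (((c : ℤ) - 1) * (d - 1)) * (jacobiSym d c : ℤ)) := by
    rw [← neg_one_mul (c : ℤ), jacobiSym.mul_left, Int.cast_mul, jacobiSym_neg_one_eq hd,
      jacobiSym_reciprocity_eq hc hd]
  have hz : zetaEight ^ (2 * ((d : ℤ) - 1)) * zetaEight ^ (((c : ℤ) - 1) * (d - 1)) *
      zetaEight ^ ((d : ℤ) * (b + -c - 3)) * zetaEight ^ (3 : ℤ) =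
      zetaEight ^ ((c : ℤ) * (a + d - 3)) := by
    simp only [← zpow_add₀ zetaEight_ne_zero]
    apply zetaEight_zpow_congr
    obtain ⟨k, hk⟩ := odd_sq_eq hcz
    obtain ⟨l, hl⟩ := odd_sq_eq hdz
    refine eight_dvd_of_mul_odd (hcz.mul hdz) ?_
    obtain ⟨x, hx⟩ := hcz
    obtain ⟨y, hy⟩ := hdz
    exact ⟨-k * a * d + l * b * c - k * d ^ 2 - l + 2 * k * d - 2 * c * l + (x + 1) * y, by
      linear_combination (-a * d - d ^ 2 + 2 * d) * hk + (b * c - 1 - 2 * c) * hl - hdet +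
        2 * (d - 1) * hx + 4 * (x + 1) * hy⟩
  rw [oddMultiplier, oddMultiplier, hJ, ← hz]
  ring

theorem oddMultiplier_of_neg {a b : ℤ} {c d : ℕ} (hc : Odd c) (hd : Odd d)
    (hdet : -a * d - b * c = 1) :
    oddMultiplier (-b) c d * zetaEight ^ (-3 : ℤ) = oddMultiplier a (-d) c := by
  have hcz : Odd (c : ℤ) := by exact_mod_cast hc
  have hdz : Odd (d : ℤ) := by exact_mod_cast hd
  have hJ : ((jacobiSym (-(d : ℤ)) c : ℤ) : ℂ) = zetaEight ^ (2 * ((c : ℤ) - 1)) *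
      (zetaEight ^ (((d : ℤ) - 1) * (c - 1)) * (jacobiSym c d : ℤ)) := by
    rw [← neg_one_mul (d : ℤ), jacobiSym.mul_left, Int.cast_mul, jacobiSym_neg_one_eq hc,
      jacobiSym_reciprocity_eq hd hc]
  have hz : zetaEight ^ (2 * ((c : ℤ) - 1)) * zetaEight ^ (((d : ℤ) - 1) * (c - 1)) *
      zetaEight ^ ((c : ℤ) * (a + -d - 3)) =
      zetaEight ^ ((d : ℤ) * (-b + c - 3)) * zetaEight ^ (-3 : ℤ) := by
    simp only [← zpow_add₀ zetaEight_ne_zero]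
    apply zetaEight_zpow_congr
    obtain ⟨k, hk⟩ := odd_sq_eq hcz
    obtain ⟨l, hl⟩ := odd_sq_eq hdz
    refine eight_dvd_of_mul_odd (hcz.mul hdz) ?_
    obtain ⟨x, hx⟩ := hcz
    obtain ⟨y, hy⟩ := hdz
    exact ⟨k * a * d + l * b * c - k * d ^ 2 - l - 2 * k * d + 2 * c * l + x * (y + 1), by
      linear_combination (a * d - d ^ 2 - 2 * d) * hk + (b * c - 1 + 2 * c) * hl - hdet +
        2 * (d + 1) * hx + 4 * x * hy⟩
  rw [oddMultiplier, oddMultiplier, hJ, mul_assoc, ← hz]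
  ring

/-- Euclidean algorithm: a translation replaces `d` by an odd remainder `d'` with `|d'| < c`, and an
`S`-step makes `|d'|` the new lower left entry. Only Jacobi symbols with odd moduli occur. -/
theorem thetaTransforms_of_odd (c : ℕ) (hc : Odd c) (a b d : ℤ) (hdet : a * d - b * c = 1) :
    ThetaTransforms a b c d (oddMultiplier a d c) := by
  induction c using Nat.strong_induction_on generalizing a b d with
  | _ c ih =>
  obtain ⟨n, d', hd', hn⟩ : ∃ n d' : ℤ, d = c * n + d' ∧
      (c = 1 ∧ d' = 0 ∨ Odd d' ∧ d' ≠ 0 ∧ d'.natAbs < c) := by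
    rcases eq_or_ne c 1 with rfl | hc1
    · exact ⟨d, 0, by simp, Or.inl ⟨rfl, rfl⟩⟩
    have hcpos : 0 < (c : ℤ) := by have := hc.pos; exact_mod_cast this
    have h0 := Int.emod_nonneg d hcpos.ne'
    have h1 := Int.emod_lt_of_pos d hcpos
    have h2 := Int.mul_ediv_add_emod d c
    have hr : d % c ≠ 0 := by
      intro h
      obtain ⟨e, he⟩ := Int.dvd_of_emod_eq_zero h
      have : (c : ℤ) ∣ 1 := ⟨a * e - b, by rw [← hdet, he]; ring⟩
      have := Int.eq_one_of_dvd_one hcpos.le this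
      exact hc1 (by exact_mod_cast this)
    obtain ⟨x, hx⟩ := hc
    -- As `c` is odd, exactly one of the remainders `d % c` and `d % c - c` is odd.
    rcases Int.even_or_odd (d % c) with ⟨y, hy⟩ | hodd
    · exact ⟨d / c + 1, d % c - c, by linear_combination -h2,
        Or.inr ⟨⟨y - x - 1, by omega⟩, by omega, by omega⟩⟩
    · exact ⟨d / c, d % c, by linear_combination -h2,
        Or.inr ⟨hodd, hr, by omega⟩⟩
  have hdet' : a * d' - (b - a * n) * c = 1 := by rw [hd'] at hdet; linear_combination hdet
  have main : ThetaTransforms a (b - a * n) c d' (oddMultiplier a d' c) := by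
    rcases hn with ⟨rfl, rfl⟩ | ⟨hodd, hne, hlt⟩
    · have hb : b - a * n = -1 := by push_cast at hdet'; linarith
      rw [hb]
      convert! thetaTransforms_inversion a using 1
      simp [oddMultiplier]
    · have hcpos : 0 < (c : ℤ) := by have := hc.pos; exact_mod_cast this
      rcases hne.lt_or_gt with h | h
      · obtain ⟨e, rfl⟩ : ∃ e : ℕ, d' = -e := ⟨d'.natAbs, by omega⟩
        have heodd : Odd e := by simpa using hodd
        rw [← oddMultiplier_of_neg hc heodd (b := b - a * n) (by linarith)]
        refine ThetaTransforms.of_mul_S_of_neg hcpos h ?_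
        rw [neg_neg]
        exact ih e (by simpa using hlt) heodd _ _ _ (by linarith)
      · obtain ⟨e, rfl⟩ : ∃ e : ℕ, d' = e := ⟨d'.natAbs, by omega⟩
        have heodd : Odd e := by exact_mod_cast hodd
        rw [← oddMultiplier_of_pos hc heodd (b := b - a * n) (by linarith)]
        refine ThetaTransforms.of_mul_S_of_pos hcpos h ?_
        exact ih e (by simpa using hlt) heodd _ _ _ (by linarith)
  have h := main.mul_translation n
  rw [← hd', show a * n + (b - a * n) = b by ring] at h
  convert! h using 1
  have h1 : jacobiSym d c = jacobiSym d' c := by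
    apply jacobiSym.mod_left'
    rw [hd']
    simp
  rw [oddMultiplier, oddMultiplier, h1, mul_assoc, ← zpow_add₀ zetaEight_ne_zero]
  congr 1
  apply zetaEight_zpow_congr
  -- Replacing `d'` by `d' + c n` adds `c² n ≡ n (mod 8)` to the exponent, in agreement with the
  -- translation factor.
  obtain ⟨k, hk⟩ := odd_sq_eq (c := c) (by exact_mod_cast hc)
  exact ⟨k * n, by rw [hd']; linear_combination n * hk⟩

theorem zpow_three_jacobiSym (a : ℤ) (b : ℕ) :
    ((jacobiSym a b : ℤ) : ℂ) ^ (3 : ℤ) = (jacobiSym a b : ℤ) := by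
  rw [show (3 : ℤ) = ((3 : ℕ) : ℤ) by norm_num, zpow_natCast]
  rcases jacobiSym.trichotomy a b with h | h | h <;> rw [h] <;> norm_num

theorem exp_zpow_three_eq_zetaEight_zpow (n : ℤ) :
    Complex.exp (Real.pi * Complex.I / 12 * n) ^ (3 : ℤ) = zetaEight ^ n := by
  rw [← exp_eq_zetaEight_zpow, ← Complex.exp_int_mul]
  congr 1
  push_cast
  ring

/-- The odd theta function transforms under `SL₂(ℤ)` with the cube of the multiplier of `η`. -/
theorem thetaTransforms_etaMultiplier (a b c d : ℤ) (hc : 0 < c) (hdet : a * d - b * c = 1) :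
    ThetaTransforms a b c d (etaMultiplier a b c d ^ (3 : ℤ)) := by
  obtain ⟨c, rfl⟩ : ∃ e : ℕ, c = e := ⟨c.natAbs, by omega⟩
  rcases Int.even_or_odd (c : ℤ) with hev | hodd
  · have hd : Odd d := by
      by_contra h
      rw [Int.not_odd_iff_even] at h
      have h1 : Even (a * d - b * c) := (h.mul_left a).sub (hev.mul_left b)
      rw [hdet] at h1
      exact absurd h1 (by decide)
    obtain ⟨l, hl⟩ := odd_sq_eq hd
    have hχ : etaMultiplier a b c d ^ (3 : ℤ) = (jacobiSym c d.natAbs : ℤ) *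
        zetaEight ^ (d * (b - c + 3) - 3) := by
      rw [etaMultiplier, if_neg (Int.not_odd_iff_even.2 hev), kroneckerOdd,
        if_neg (by omega), one_mul, mul_zpow, zpow_three_jacobiSym,
        exp_zpow_three_eq_zetaEight_zpow]
      congr 1
      apply zetaEight_zpow_congr
      exact ⟨-a * c * l, by linear_combination -a * c * hl⟩
    rw [hχ]
    have hd0 : d ≠ 0 := by rintro rfl; exact absurd hd (by decide)
    -- For even `c` the entry `d` is odd, so one `S`-step leads to a matrix with odd lower left
    -- entry `|d|`.
    rcases hd0.lt_or_gt with h | h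
    · obtain ⟨e, rfl⟩ : ∃ e : ℕ, d = -e := ⟨d.natAbs, by omega⟩
      have heodd : Odd e := by simpa using hd
      have h1 := thetaTransforms_of_odd e heodd (-b) a c (by linarith)
      rw [← neg_neg (e : ℤ)] at h1
      convert! h1.of_mul_S_of_neg hc h using 1
      rw [oddMultiplier, mul_assoc, ← zpow_add₀ zetaEight_ne_zero, Int.natAbs_neg, Int.natAbs_natCast]
      congr 2
      ring
    · obtain ⟨e, rfl⟩ : ∃ e : ℕ, d = e := ⟨d.natAbs, by omega⟩
      have heodd : Odd e := by exact_mod_cast hd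
      have h1 := thetaTransforms_of_odd e heodd b (-a) (-c) (by linarith)
      convert! h1.of_mul_S_of_pos hc h using 1
      rw [oddMultiplier, ← neg_one_mul (c : ℤ), jacobiSym.mul_left, Int.cast_mul,
        jacobiSym_neg_one_eq heodd, Int.natAbs_natCast, mul_comm (zetaEight ^ _), mul_assoc,
        mul_assoc, ← zpow_add₀ zetaEight_ne_zero, ← zpow_add₀ zetaEight_ne_zero]
      congr 1
      apply zetaEight_zpow_congr
      obtain ⟨y, hy⟩ := hd
      exact ⟨y, by linear_combination 4 * hy⟩
  · have hoddn : Odd c := by exact_mod_cast hodd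
    obtain ⟨k, hk⟩ := odd_sq_eq hodd
    have hχ : etaMultiplier a b c d ^ (3 : ℤ) = oddMultiplier a d c := by
      rw [etaMultiplier, if_pos hodd, kroneckerOdd,
        if_neg (by simp), one_mul, mul_zpow, zpow_three_jacobiSym,
        exp_zpow_three_eq_zetaEight_zpow, oddMultiplier]
      simp only [Nat.abs_cast, Int.natAbs_natCast]
      congr 1
      apply zetaEight_zpow_congr
      exact ⟨-b * d * k, by linear_combination -b * d * hk⟩
    rw [hχ]
    exact thetaTransforms_of_odd c hoddn a b d hdet

/-! ### Unary theta functions with characteristics -/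

/-- The term `(-1)^n exp (π i (m + A)² w + 2 π i m B)`, with `m = n + 1/2`. -/
def thetaChar (A B : ℝ) (w : ℂ) (n : ℤ) : ℂ :=
  (-1) ^ n * Complex.exp (Real.pi * Complex.I * ((half n + A : ℝ) : ℂ) ^ 2 * w +
    2 * Real.pi * Complex.I * (half n : ℂ) * B)

/-- The unary theta function `∑ (-1)^n (m + A) exp (π i (m + A)² w + 2 π i m B)` of weight `3/2`. -/
def unaryTheta (A B : ℝ) (w : ℂ) : ℂ := ∑' n : ℤ, ((half n + A : ℝ) : ℂ) * thetaChar A B w n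

/-- The completed false theta function `∑ (-1)^n exp (π i (m + A)² τ + 2 π i m B) erf (√π (m + A) s)`. -/
def completedFalseTheta (A B : ℝ) (τ s : ℂ) : ℂ :=
  ∑' n : ℤ, thetaChar A B τ n * cerf (((√Real.pi * (half n + A) : ℝ) : ℂ) * s)

theorem norm_neg_one_zpow (n : ℤ) : ‖(-1 : ℂ) ^ n‖ = 1 := by
  rw [norm_zpow]; simp

theorem norm_thetaChar (A B : ℝ) (w : ℂ) (n : ℤ) :
    ‖thetaChar A B w n‖ = Real.exp (-(Real.pi * (half n + A) ^ 2 * w.im)) := by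
  rw [thetaChar, norm_mul, norm_neg_one_zpow, one_mul, Complex.norm_exp]
  congr 1
  rw [show (Real.pi * Complex.I * ((half n + A : ℝ) : ℂ) ^ 2 * w +
    2 * Real.pi * Complex.I * (half n : ℂ) * B : ℂ) =
    ((Real.pi * (half n + A) ^ 2 : ℝ) : ℂ) * (w * Complex.I) +
      ((2 * Real.pi * half n * B : ℝ) : ℂ) * Complex.I by push_cast; ring, Complex.add_re,
      Complex.re_ofReal_mul, Complex.re_ofReal_mul]
  simp

theorem summable_one_add_abs_mul_gaussian (A : ℝ) {y : ℝ} (hy : 0 < y) :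
    Summable fun n : ℤ => (1 + |half n + A|) * Real.exp (-(Real.pi * (half n + A) ^ 2 * y)) := by
  set a := |1 / 2 + A| with ha
  have h0 := summable_pow_mul_jacobiTheta₂_term_bound (a * y) hy 0
  have h1 := summable_pow_mul_jacobiTheta₂_term_bound (a * y) hy 1
  refine Summable.of_nonneg_of_le (fun n => by positivity) (fun n => ?_)
    ((h0.mul_left (1 + a)).add h1)
  rw [pow_zero, pow_one, one_mul, ← add_mul]
  have hx : half n + A = n + (1 / 2 + A) := by rw [half]; ring
  have habs : |(n : ℝ) + (1 / 2 + A)| ≤ |(n : ℝ)| + a := abs_add_le _ _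
  push_cast
  rw [hx]
  refine mul_le_mul (by linarith) (Real.exp_le_exp.2 ?_) (Real.exp_pos _).le (by positivity)
  have h2 : -(|(n : ℝ)| * a) ≤ (n : ℝ) * (1 / 2 + A) := by
    rw [ha, ← abs_mul]; exact neg_abs_le _
  have h3 : (n : ℝ) ^ 2 - 2 * (a * |(n : ℝ)|) ≤ ((n : ℝ) + (1 / 2 + A)) ^ 2 := by
    nlinarith [sq_nonneg (1 / 2 + A)]
  have := mul_le_mul_of_nonneg_left h3 (mul_pos Real.pi_pos hy).le
  linarith

theorem summable_abs_mul_gaussian (A : ℝ) {y : ℝ} (hy : 0 < y) :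
    Summable fun n : ℤ => |half n + A| * Real.exp (-(Real.pi * (half n + A) ^ 2 * y)) :=
  (summable_one_add_abs_mul_gaussian A hy).of_nonneg_of_le (fun n => by positivity)
    fun n => by gcongr; linarith

theorem summable_gaussian (A : ℝ) {y : ℝ} (hy : 0 < y) :
    Summable fun n : ℤ => Real.exp (-(Real.pi * (half n + A) ^ 2 * y)) :=
  (summable_one_add_abs_mul_gaussian A hy).of_nonneg_of_le (fun n => by positivity)
    fun n => by
      have := abs_nonneg (half n + A)
      nlinarith [Real.exp_pos (-(Real.pi * (half n + A) ^ 2 * y))]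

theorem norm_mul_thetaChar (A B : ℝ) (w : ℂ) (n : ℤ) :
    ‖((half n + A : ℝ) : ℂ) * thetaChar A B w n‖ =
      |half n + A| * Real.exp (-(Real.pi * (half n + A) ^ 2 * w.im)) := by
  rw [norm_mul, norm_thetaChar, Complex.norm_real, Real.norm_eq_abs]

theorem summable_mul_thetaChar (A B : ℝ) {w : ℂ} (hw : 0 < w.im) :
    Summable fun n => ((half n + A : ℝ) : ℂ) * thetaChar A B w n :=
  Summable.of_norm_bounded (summable_abs_mul_gaussian A hw)
    fun n => (norm_mul_thetaChar A B w n).le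

theorem norm_sign_le (x : ℝ) : ‖((Real.sign x : ℝ) : ℂ)‖ ≤ 1 := by
  rw [Complex.norm_real]
  rcases Real.sign_apply_eq x with h | h | h <;> rw [h] <;> simp

theorem summable_sign_mul_thetaChar (A B : ℝ) {w : ℂ} (hw : 0 < w.im) :
    Summable fun n => (Real.sign (half n + A) : ℂ) * thetaChar A B w n :=
  Summable.of_norm_bounded (summable_gaussian A hw) fun n => by
    rw [norm_mul, norm_thetaChar]
    exact mul_le_of_le_one_left (Real.exp_pos _).le (norm_sign_le _)

theorem sqrt_pi_sq : ((√Real.pi : ℝ) : ℂ) ^ 2 = Real.pi := by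
  rw [← Complex.ofReal_pow, Real.sq_sqrt Real.pi_pos.le]

theorem re_sqrt_pi_mul_sq (x : ℝ) (s : ℂ) :
    ((((√Real.pi * x : ℝ) : ℂ) * s) ^ 2).re = Real.pi * x ^ 2 * (s ^ 2).re := by
  rw [mul_pow, ← Complex.ofReal_pow, Complex.re_ofReal_mul, mul_pow, Real.sq_sqrt Real.pi_pos.le]

theorem im_add_I_mul_sq (τ s : ℂ) : (τ + Complex.I * s ^ 2).im = τ.im + (s ^ 2).re := by
  simp

/-- The theta term decays like `exp(-π (m + A)² Im τ)`, while erf grows at most like `exp(-π (m +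
A)² Re s²)` if `Re s² < 0`, up to a linear factor. Hence the rate `min (Im τ) (Im (τ + i s²))`. -/
theorem summable_completedFalseTheta (A B : ℝ) {τ s : ℂ} (hτ : 0 < τ.im)
    (hs : 0 < (τ + Complex.I * s ^ 2).im) :
    Summable fun n => thetaChar A B τ n * cerf (((√Real.pi * (half n + A) : ℝ) : ℂ) * s) := by
  rw [im_add_I_mul_sq] at hs
  have hy : 0 < min τ.im (τ.im + (s ^ 2).re) := lt_min hτ hs
  refine Summable.of_norm_bounded ((summable_abs_mul_gaussian A hy).mul_left
    (2 * (√Real.pi * ‖s‖))) fun n => ?_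
  rw [norm_mul, norm_thetaChar]
  have h1 := norm_cerf_le (((√Real.pi * (half n + A) : ℝ) : ℂ) * s)
  rw [re_sqrt_pi_mul_sq, norm_mul, Complex.norm_real, Real.norm_eq_abs, abs_mul,
    abs_of_nonneg (Real.sqrt_nonneg _)] at h1
  have hp : 0 ≤ Real.pi * (half n + A) ^ 2 := by positivity
  calc _ ≤ Real.exp (-(Real.pi * (half n + A) ^ 2 * τ.im)) *
        (2 * (√Real.pi * |half n + A| * ‖s‖) *
          Real.exp (max 0 (-(Real.pi * (half n + A) ^ 2 * (s ^ 2).re)))) := by gcongr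
    _ = 2 * (√Real.pi * ‖s‖) * (|half n + A| * Real.exp (-(Real.pi * (half n + A) ^ 2 * τ.im) +
          max 0 (-(Real.pi * (half n + A) ^ 2 * (s ^ 2).re)))) := by
        rw [Real.exp_add]; ring
    _ ≤ _ := by
        gcongr
        rcases le_total 0 (s ^ 2).re with h | h
        · rw [max_eq_left (by nlinarith)]
          nlinarith [min_le_left τ.im (τ.im + (s ^ 2).re)]
        · rw [max_eq_right (by nlinarith)]
          nlinarith [min_le_right τ.im (τ.im + (s ^ 2).re)]

/-- The Gaussian produced by differentiating erf moves the modulus from `τ` to `τ + i s²`; this is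
where modularity enters. -/
theorem thetaChar_add_I_mul_sq (A B : ℝ) (τ s : ℂ) (n : ℤ) :
    thetaChar A B (τ + Complex.I * s ^ 2) n = thetaChar A B τ n *
      Complex.exp (-(((√Real.pi * (half n + A) : ℝ) : ℂ) * s) ^ 2) := by
  rw [thetaChar, thetaChar, mul_assoc ((-1 : ℂ) ^ n), ← Complex.exp_add]
  congr 2
  have h := sqrt_pi_sq
  push_cast
  linear_combination (Real.pi * (half n + A) ^ 2 * s ^ 2 : ℂ) * Complex.I_sq +
    ((half n + A) ^ 2 * s ^ 2 : ℂ) * h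

theorem hasDerivAt_thetaChar_mul_cerf (A B : ℝ) (τ s : ℂ) (n : ℤ) :
    HasDerivAt (fun s => thetaChar A B τ n * cerf (((√Real.pi * (half n + A) : ℝ) : ℂ) * s))
      (2 * (((half n + A : ℝ) : ℂ) * thetaChar A B (τ + Complex.I * s ^ 2) n)) s := by
  have h1 := ((hasDerivAt_cerf (((√Real.pi * (half n + A) : ℝ) : ℂ) * s)).comp s
    ((hasDerivAt_id s).const_mul ((√Real.pi * (half n + A) : ℝ) : ℂ))).const_mul
    (thetaChar A B τ n)
  refine h1.congr_deriv ?_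
  rw [thetaChar_add_I_mul_sq]
  have : ((√Real.pi : ℝ) : ℂ) ≠ 0 := by
    rw [Complex.ofReal_ne_zero]; positivity
  push_cast
  field_simp

theorem hasDerivAt_completedFalseTheta (A B : ℝ) {τ s : ℂ} (hτ : 0 < τ.im)
    (hs : 0 < (τ + Complex.I * s ^ 2).im) :
    HasDerivAt (completedFalseTheta A B τ) (2 * unaryTheta A B (τ + Complex.I * s ^ 2)) s := by
  set y := (τ + Complex.I * s ^ 2).im with hy
  have hopen : IsOpen {s' : ℂ | y / 2 < (τ + Complex.I * s' ^ 2).im} :=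
    isOpen_lt continuous_const (by fun_prop)
  obtain ⟨r, hr, hball⟩ := Metric.isOpen_iff.1 hopen s (by
    change y / 2 < (τ + Complex.I * s ^ 2).im
    linarith)
  have hsum := (summable_abs_mul_gaussian A (half_pos hs)).mul_left 2
  have key := hasDerivAt_tsum_of_isPreconnected (𝕜 := ℂ) (F := ℂ) hsum Metric.isOpen_ball
    (convex_ball s r).isPreconnected
    (g := fun n s => thetaChar A B τ n * cerf (((√Real.pi * (half n + A) : ℝ) : ℂ) * s))
    (g' := fun n s => 2 * (((half n + A : ℝ) : ℂ) * thetaChar A B (τ + Complex.I * s ^ 2) n))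
    (y := s) (y₀ := s) ?_ ?_ (Metric.mem_ball_self hr) (summable_completedFalseTheta A B hτ hs)
    (Metric.mem_ball_self hr)
  · rw [tsum_mul_left] at key
    exact key
  · intro n s' _
    exact hasDerivAt_thetaChar_mul_cerf A B τ s' n
  · intro n s' hs'
    rw [norm_mul, norm_mul_thetaChar, Complex.norm_ofNat]
    have := hball hs'
    gcongr
    exact (this : y / 2 < _).le

theorem completedFalseTheta_zero (A B : ℝ) (τ : ℂ) : completedFalseTheta A B τ 0 = 0 := by
  simp [completedFalseTheta, cerf_zero]

theorem sign_sqrt_pi_mul (x : ℝ) : Real.sign (√Real.pi * x) = Real.sign x := by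
  have h : 0 < √Real.pi := by positivity
  rcases lt_trichotomy x 0 with hx | rfl | hx
  · rw [Real.sign_of_neg hx, Real.sign_of_neg (mul_neg_of_pos_of_neg h hx)]
  · simp
  · rw [Real.sign_of_pos hx, Real.sign_of_pos (mul_pos h hx)]

theorem tendsto_completedFalseTheta (A B : ℝ) {τ : ℂ} (hτ : 0 < τ.im) {ι : Type*} {l : Filter ι}
    {s : ι → ℂ} (hs : ∀ᶠ i in l, 0 < (s i).re)
    (hs2 : Tendsto (fun i => (s i ^ 2).re) l atTop) :
    Tendsto (fun i => completedFalseTheta A B τ (s i)) l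
      (𝓝 (∑' n, (Real.sign (half n + A) : ℂ) * thetaChar A B τ n)) := by
  refine tendsto_tsum_of_dominated_convergence ((summable_gaussian A hτ).mul_right 2) ?_ ?_
  · intro n
    have := (tendsto_cerf_mul hs hs2 (√Real.pi * (half n + A))).const_mul (thetaChar A B τ n)
    rwa [sign_sqrt_pi_mul, mul_comm (thetaChar A B τ n)] at this
  · filter_upwards [hs2.eventually_ge_atTop 0] with i hi n
    rw [norm_mul, norm_thetaChar]
    gcongr
    apply norm_cerf_le_two
    rw [re_sqrt_pi_mul_sq]
    positivity

/-- The exponents `π (m + A)²` of the nonzero terms of a unary theta function are bounded below. -/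
theorem exists_pos_le_pi_mul_sq (A : ℝ) :
    ∃ δ > 0, ∀ n : ℤ, half n + A ≠ 0 → δ ≤ Real.pi * (half n + A) ^ 2 := by
  obtain ⟨δ, hδ, h⟩ : ∃ δ > 0, ∀ n : ℤ, half n + A ≠ 0 → δ ≤ |half n + A| := by
    set a := 1 / 2 + A with ha
    have hx : ∀ n : ℤ, half n + A = a - ((-n : ℤ) : ℝ) := by
      intro n; rw [half, ha]; push_cast; ring
    -- The numbers `m + A` are the differences between `a` and the integers: nonzero ones are at
    -- least 1 in size if `a` is an integer, and otherwise at least the distance to the nearest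
    -- integer.
    by_cases hr : a = round a
    · refine ⟨1, one_pos, fun n hn => ?_⟩
      rw [hx, hr] at hn ⊢
      rw [← Int.cast_sub] at hn ⊢
      rw [← Int.cast_abs]
      exact_mod_cast Int.one_le_abs (by exact_mod_cast hn)
    · refine ⟨|a - round a|, abs_pos.2 (sub_ne_zero.2 hr), fun n _ => ?_⟩
      rw [hx]
      exact round_le a _
  refine ⟨Real.pi * δ ^ 2, by positivity, fun n hn => ?_⟩
  rw [← sq_abs (half n + A)]
  have := h n hn
  gcongr

theorem exists_norm_mul_thetaChar_le (A B : ℝ) : ∃ δ > 0, ∀ y : ℝ, ∀ w : ℂ, y ≤ w.im → ∀ n : ℤ,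
    ‖((half n + A : ℝ) : ℂ) * thetaChar A B w n‖ ≤
      |half n + A| * Real.exp (-(Real.pi * (half n + A) ^ 2 * y)) * Real.exp (-δ * (w.im - y)) := by
  obtain ⟨δ, hδ, h⟩ := exists_pos_le_pi_mul_sq A
  refine ⟨δ, hδ, fun y w hw n => ?_⟩
  rw [norm_mul_thetaChar]
  by_cases hn : half n + A = 0
  · simp [hn]
  · rw [mul_assoc |half n + A|, ← Real.exp_add]
    gcongr
    nlinarith [mul_le_mul_of_nonneg_right (h n hn) (sub_nonneg.2 hw)]

/-- Exponential decay at `i∞` of (partial sums over a set of indices of) a unary theta function. -/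
theorem exists_norm_tsum_mul_thetaChar_le (A B : ℝ) {y : ℝ} (hy : 0 < y) :
    ∃ δ > 0, ∃ C, ∀ S : Set ℤ, ∀ w : ℂ, y ≤ w.im →
      ‖∑' n : S, ((half n + A : ℝ) : ℂ) * thetaChar A B w n‖ ≤ C * Real.exp (-δ * w.im) := by
  obtain ⟨δ, hδ, h⟩ := exists_norm_mul_thetaChar_le A B
  refine ⟨δ, hδ, (∑' n : ℤ, |half n + A| * Real.exp (-(Real.pi * (half n + A) ^ 2 * y))) *
    Real.exp (δ * y), fun S w hw => ?_⟩
  have hsum := summable_abs_mul_gaussian A hy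
  have h1 := (hsum.mul_right (Real.exp (-δ * (w.im - y))))
  have h2 := tsum_of_norm_bounded (h1.subtype S).hasSum (fun n : S => h y w hw n.1)
  refine h2.trans ((Summable.tsum_subtype_le _ S (fun n => by positivity) h1).trans (le_of_eq ?_))
  rw [tsum_mul_right, mul_assoc, ← Real.exp_add]
  congr 2
  ring

/-! ### Transformation of unary theta functions -/

theorem im_moebius_pos {a b c d : ℤ} (hc : 0 < c) (hdet : a * d - b * c = 1) {τ : ℂ}
    (hτ : 0 < τ.im) : 0 < ((a * τ + b) / (c * τ + d) : ℂ).im := by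
  have hJ := im_int_mul_add hc d hτ
  have hJ0 : (c : ℂ) * τ + d ≠ 0 := by intro h0; rw [h0] at hJ; simp at hJ
  have hc0 : (c : ℂ) ≠ 0 := by exact_mod_cast hc.ne'
  have hdet' : (a : ℂ) * d - b * c = 1 := by exact_mod_cast hdet
  have h1 : ((a * τ + b) / (c * τ + d) : ℂ) =
      ((a / c : ℝ) : ℂ) + ((1 / c : ℝ) : ℂ) * (-1 / (c * τ + d)) := by
    push_cast
    generalize hJe : (c : ℂ) * τ + d = J at hJ0
    field_simp
    linear_combination a * hJe - hdet'
  rw [h1, Complex.add_im, Complex.ofReal_im, zero_add, Complex.im_ofReal_mul]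
  have : (0 : ℝ) < c := by exact_mod_cast hc
  exact mul_pos (by positivity) (im_neg_one_div hJ)

/-- The derivative of the odd theta function with respect to `z`. -/
def oddThetaDeriv (z τ : ℂ) : ℂ :=
  ∑' n : ℤ, 2 * Real.pi * Complex.I * (half n : ℂ) * oddThetaTerm z τ n

theorem hasSum_oddThetaDeriv_aux (z : ℂ) {τ : ℂ} (hτ : 0 < τ.im) :
    HasSum (fun n : ℤ => 2 * Real.pi * Complex.I * (half n : ℂ) * oddThetaTerm z τ n)
      (Complex.exp (Real.pi * Complex.I * (τ / 4 + z)) *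
        (Real.pi * Complex.I * jacobiTheta₂ (z + τ / 2 + 1 / 2) τ +
          jacobiTheta₂' (z + τ / 2 + 1 / 2) τ)) := by
  refine ((((hasSum_jacobiTheta₂_term (z + τ / 2 + 1 / 2) hτ).mul_left
    (Real.pi * Complex.I)).add (hasSum_jacobiTheta₂'_term (z + τ / 2 + 1 / 2) hτ)).mul_left
    (Complex.exp (Real.pi * Complex.I * (τ / 4 + z)))).congr_fun ?_
  intro n
  rw [oddThetaTerm_eq, jacobiTheta₂'_term, half_cast]
  ring

theorem hasSum_oddThetaDeriv (z : ℂ) {τ : ℂ} (hτ : 0 < τ.im) :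
    HasSum (fun n : ℤ => 2 * Real.pi * Complex.I * (half n : ℂ) * oddThetaTerm z τ n)
      (oddThetaDeriv z τ) :=
  (hasSum_oddThetaDeriv_aux z hτ).summable.hasSum

theorem hasDerivAt_oddTheta (z : ℂ) {τ : ℂ} (hτ : 0 < τ.im) :
    HasDerivAt (fun z => oddTheta z τ) (oddThetaDeriv z τ) z := by
  have h1 : HasDerivAt (fun z : ℂ => z + τ / 2 + 1 / 2) 1 z :=
    ((hasDerivAt_id z).add_const _).add_const _
  have h2 : HasDerivAt (fun z : ℂ => Real.pi * Complex.I * (τ / 4 + z)) (Real.pi * Complex.I) z := by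
    simpa using ((hasDerivAt_id z).const_add (τ / 4)).const_mul (Real.pi * Complex.I)
  have h3 := h2.cexp.mul ((hasDerivAt_jacobiTheta₂_fst (z + τ / 2 + 1 / 2) hτ).comp z h1)
  refine h3.congr_deriv ?_
  rw [oddThetaDeriv, (hasSum_oddThetaDeriv_aux z hτ).tsum_eq]
  simp only [Function.comp]
  ring

/-- The factor `m + A` comes from the `z`-derivative (for `m`) and the function itself (for `A`);
completing the square gives the prefactor. -/
theorem unaryTheta_eq (A B : ℝ) {w : ℂ} (hw : 0 < w.im) :
    2 * Real.pi * Complex.I * unaryTheta A B w = Complex.exp (Real.pi * Complex.I * A ^ 2 * w) *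
      (oddThetaDeriv (B + A * w) w + 2 * Real.pi * Complex.I * A * oddTheta (B + A * w) w) := by
  have h1 := ((hasSum_oddThetaDeriv (B + A * w) hw).add
    ((hasSum_oddTheta (B + A * w) hw).mul_left (2 * Real.pi * Complex.I * A))).mul_left
    (Complex.exp (Real.pi * Complex.I * A ^ 2 * w))
  rw [← h1.tsum_eq, unaryTheta, ← tsum_mul_left]
  congr 1
  ext n
  rw [thetaChar, oddThetaTerm]
  have : Complex.exp (Real.pi * Complex.I * ((half n + A : ℝ) : ℂ) ^ 2 * w +
      2 * Real.pi * Complex.I * (half n : ℂ) * B) =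
      Complex.exp (Real.pi * Complex.I * A ^ 2 * w) *
      Complex.exp (Real.pi * Complex.I * (half n : ℂ) ^ 2 * w +
        2 * Real.pi * Complex.I * (half n : ℂ) * (B + A * w)) := by
    rw [← Complex.exp_add]
    congr 1
    push_cast
    ring
  rw [this]
  push_cast
  ring

theorem ThetaTransforms.deriv {a b c d : ℤ} {v : ℂ} (h : ThetaTransforms a b c d v) (hc : 0 < c)
    (hdet : a * d - b * c = 1) (z : ℂ) {τ : ℂ} (hτ : 0 < τ.im) :
    oddThetaDeriv (z / (c * τ + d)) ((a * τ + b) / (c * τ + d)) =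
      v * csqrt (c * τ + d) * Complex.exp (Real.pi * Complex.I * c * z ^ 2 / (c * τ + d)) *
        (2 * Real.pi * Complex.I * c * z * oddTheta z τ + (c * τ + d) * oddThetaDeriv z τ) := by
  have hJ := im_int_mul_add hc d hτ
  have hJ0 : (c : ℂ) * τ + d ≠ 0 := by intro h0; rw [h0] at hJ; simp at hJ
  have hγ := im_moebius_pos hc hdet hτ
  have h1 := (hasDerivAt_oddTheta (z / (c * τ + d)) hγ).comp z
    ((hasDerivAt_id z).div_const (c * τ + d : ℂ))
  have h2 : HasDerivAt (fun z : ℂ => Real.pi * Complex.I * c * z ^ 2 / (c * τ + d))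
      (2 * Real.pi * Complex.I * c * z / (c * τ + d)) z := by
    refine ((((hasDerivAt_id z).pow 2).const_mul (Real.pi * Complex.I * c)).div_const
      (c * τ + d : ℂ)).congr_deriv ?_
    simp only [id]
    push_cast
    ring
  have h3 := (h2.cexp.const_mul (v * csqrt (c * τ + d))).mul (hasDerivAt_oddTheta z hτ)
  have h4 := h1.unique (h3.congr_of_eventuallyEq (Eventually.of_forall fun z => h z τ hτ))
  generalize (c : ℂ) * τ + d = J at *
  field_simp at h4
  rw [h4]
  field_simp

/-- The characteristics form a row vector with `(A₀, B₀) = (A₁, B₁) γ`. The identities match, in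
turn, the elliptic variables, the factors in front of the undifferentiated theta function, and the
exponents. -/
theorem characteristic_identities {a b c d : ℤ} (hdet : a * d - b * c = 1) {A₀ B₀ A₁ B₁ : ℝ}
    (hA : A₀ = c * B₁ + a * A₁) (hB : B₀ = d * B₁ + b * A₁) {τ : ℂ} (hJ0 : (c : ℂ) * τ + d ≠ 0) :
    (B₁ : ℂ) + A₁ * ((a * τ + b) / (c * τ + d)) = (B₀ + A₀ * τ) / (c * τ + d) ∧
    (A₁ : ℂ) + c * (B₀ + A₀ * τ) = (c * τ + d) * A₀ ∧
    (A₁ : ℂ) ^ 2 * ((a * τ + b) / (c * τ + d)) + A₁ * B₁ + c * (B₀ + A₀ * τ) ^ 2 / (c * τ + d) =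
      A₀ ^ 2 * τ + A₀ * B₀ := by
  have hA' : (A₀ : ℂ) = c * B₁ + a * A₁ := by rw [hA]; push_cast; ring
  have hB' : (B₀ : ℂ) = d * B₁ + b * A₁ := by rw [hB]; push_cast; ring
  have hdet' : (a : ℂ) * d - b * c = 1 := by exact_mod_cast hdet
  have hz1 : (B₁ : ℂ) + A₁ * ((a * τ + b) / (c * τ + d)) = (B₀ + A₀ * τ) / (c * τ + d) := by
    rw [hA', hB']
    generalize hJe : (c : ℂ) * τ + d = J at hJ0
    field_simp
    linear_combination -(B₁ : ℂ) * hJe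
  have hJA : (A₁ : ℂ) + c * (B₀ + A₀ * τ) = (c * τ + d) * A₀ := by
    rw [hA', hB']
    linear_combination -(A₁ : ℂ) * hdet'
  refine ⟨hz1, hJA, ?_⟩
  have h1 : (A₁ : ℂ) ^ 2 * ((a * τ + b) / (c * τ + d)) + A₁ * B₁ =
      A₁ * ((B₀ + A₀ * τ) / (c * τ + d)) := by
    rw [← hz1]; ring
  have h2 : (B₀ + A₀ * τ) / (c * τ + d) * (c * τ + d) = B₀ + A₀ * τ := div_mul_cancel₀ _ hJ0
  linear_combination h1 + (B₀ + A₀ * τ) / (c * τ + d) * hJA + A₀ * h2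

/-- Differentiating the theta law in `z` produces an extra multiple of `c z`. Together with the term
in `A₁` it gives `(cτ + d) A₀`, so the combination in `unaryTheta_eq` reproduces itself with weight
`1/2 + 1`. -/
theorem ThetaTransforms.unaryTheta_moebius {a b c d : ℤ} {v : ℂ} (h : ThetaTransforms a b c d v)
    (hc : 0 < c) (hdet : a * d - b * c = 1) {A₀ B₀ A₁ B₁ : ℝ} (hA : A₀ = c * B₁ + a * A₁)
    (hB : B₀ = d * B₁ + b * A₁) {τ : ℂ} (hτ : 0 < τ.im) :
    unaryTheta A₁ B₁ ((a * τ + b) / (c * τ + d)) * Complex.exp (Real.pi * Complex.I * (A₁ * B₁)) =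
      v * csqrt (c * τ + d) ^ 3 * Complex.exp (Real.pi * Complex.I * (A₀ * B₀)) *
        unaryTheta A₀ B₀ τ := by
  have hJ := im_int_mul_add hc d hτ
  have hJ0 : (c : ℂ) * τ + d ≠ 0 := by intro h0; rw [h0] at hJ; simp at hJ
  have hγ := im_moebius_pos hc hdet hτ
  obtain ⟨hz1, hJA, hchar⟩ := characteristic_identities hdet hA hB hJ0
  set z : ℂ := B₀ + A₀ * τ with hz
  have e1 := unaryTheta_eq A₁ B₁ hγ
  have e0 := unaryTheta_eq A₀ B₀ hτ
  rw [hz1, h.deriv hc hdet z hτ, h z τ hτ] at e1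
  have hE : Complex.exp (Real.pi * Complex.I * A₁ ^ 2 * ((a * τ + b) / (c * τ + d))) *
      Complex.exp (Real.pi * Complex.I * (A₁ * B₁)) *
      Complex.exp (Real.pi * Complex.I * c * z ^ 2 / (c * τ + d)) =
      Complex.exp (Real.pi * Complex.I * A₀ ^ 2 * τ) *
      Complex.exp (Real.pi * Complex.I * (A₀ * B₀)) := by
    simp only [← Complex.exp_add]
    congr 1
    linear_combination (Real.pi * Complex.I) * hchar
  have h2pi : (2 * Real.pi * Complex.I : ℂ) ≠ 0 := Complex.two_pi_I_ne_zero
  apply mul_left_cancel₀ h2pi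
  have hs := csqrt_sq (c * τ + d)
  generalize Complex.exp (Real.pi * Complex.I * A₁ ^ 2 * ((a * τ + b) / (c * τ + d))) = E1 at *
  generalize Complex.exp (Real.pi * Complex.I * (A₁ * B₁)) = P1 at *
  generalize Complex.exp (Real.pi * Complex.I * c * z ^ 2 / (c * τ + d)) = E at *
  generalize Complex.exp (Real.pi * Complex.I * A₀ ^ 2 * τ) = E0 at *
  generalize Complex.exp (Real.pi * Complex.I * (A₀ * B₀)) = P0 at *
  generalize csqrt (c * τ + d) = s at *
  set U := oddThetaDeriv z τ + 2 * Real.pi * Complex.I * A₀ * oddTheta z τ with hU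
  have e2 : 2 * Real.pi * Complex.I * unaryTheta A₁ B₁ ((a * τ + b) / (c * τ + d)) =
      E1 * E * v * s * (c * τ + d) * U := by
    rw [e1, hU]
    linear_combination E1 * E * v * s * 2 * Real.pi * Complex.I * oddTheta z τ * hJA
  rw [← mul_assoc, e2]
  rw [← hs] at *
  linear_combination v * s ^ 3 * U * hE - v * s ^ 3 * P0 * e0

/-! ### Transformation of the completed false theta function -/

theorem inv_re_pos {x : ℂ} (hx : 0 < x.re) : 0 < x⁻¹.re := by
  rw [Complex.inv_re]
  exact div_pos hx (Complex.normSq_pos.2 (by rintro rfl; simp at hx))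

theorem csqrt_inv {x : ℂ} (hx : x ∈ Complex.slitPlane) : csqrt x⁻¹ = (csqrt x)⁻¹ :=
  csqrt_eq_of_sq (by rw [inv_pow, csqrt_sq]) (inv_re_pos (csqrt_re_pos hx))

/-- The square root `s · √(cτ + d) / √(a - c (γτ + i s²))` of `-i (γ⁻¹ (γτ + i s²) - τ)`. -/
def moebiusRoot (a c : ℤ) (J τ₁ s : ℂ) : ℂ :=
  s * csqrt J / csqrt (a - c * (τ₁ + Complex.I * s ^ 2))

theorem im_sub_int_mul_neg {c : ℤ} (hc : 0 < c) (a : ℤ) {w : ℂ} (hw : 0 < w.im) :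
    ((a : ℂ) - c * w).im < 0 := by
  have : (0 : ℝ) < c := by exact_mod_cast hc
  simp only [Complex.sub_im, Complex.mul_im, Complex.intCast_re, Complex.intCast_im, zero_mul,
    add_zero, zero_sub]
  nlinarith [mul_pos this hw]

/-- The identities between a point `w` of the upper half-plane and `γ⁻¹ w`. -/
theorem inverse_moebius_identities {a b c d : ℤ} (hc : 0 < c) (hdet : a * d - b * c = 1) {w : ℂ}
    (hw : 0 < w.im) :
    (c : ℂ) * ((d * w - b) / (a - c * w)) + d = ((a : ℂ) - c * w)⁻¹ ∧
    (a * ((d * w - b) / (a - c * w)) + b) / (c * ((d * w - b) / (a - c * w)) + d) = w ∧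
    0 < ((d * w - b) / (a - c * w)).im := by
  have hp := im_sub_int_mul_neg hc a hw
  have hp0 : (a : ℂ) - c * w ≠ 0 := by intro h; rw [h] at hp; simp at hp
  have hc0 : (c : ℂ) ≠ 0 := by exact_mod_cast hc.ne'
  have hdet' : (a : ℂ) * d - b * c = 1 := by exact_mod_cast hdet
  have h1 : (c : ℂ) * ((d * w - b) / (a - c * w)) + d = ((a : ℂ) - c * w)⁻¹ := by
    field_simp
    linear_combination hdet'
  refine ⟨h1, ?_, ?_⟩
  · rw [h1]
    generalize hpe : (a : ℂ) - c * w = p at hp0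
    field_simp
    linear_combination w * hdet' - b * hpe
  · have h2 : ((d * w - b) / (a - c * w) : ℂ) =
        ((-(d / c) : ℝ) : ℂ) + ((1 / c : ℝ) : ℂ) * (-1 / (-(a - c * w))) := by
      have h3 : (-1 / (-(a - c * w)) : ℂ) = c * ((d * w - b) / (a - c * w)) + d := by
        rw [h1, neg_div_neg_eq, one_div]
      rw [h3]
      push_cast
      field_simp
      ring
    rw [h2, Complex.add_im, Complex.ofReal_im, zero_add, Complex.im_ofReal_mul]
    have : (0 : ℝ) < c := by exact_mod_cast hc
    exact mul_pos (by positivity) (im_neg_one_div (by rw [Complex.neg_im]; linarith))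

section
variable {a b c d : ℤ} {τ₀ τ₁ : ℂ}

theorem sub_int_mul_moebius (hc : 0 < c) (hdet : a * d - b * c = 1) (hτ₀ : 0 < τ₀.im)
    (hτ₁ : τ₁ = (a * τ₀ + b) / (c * τ₀ + d)) : (a : ℂ) - c * τ₁ = (c * τ₀ + d)⁻¹ := by
  have hJ := im_int_mul_add hc d hτ₀
  have hJ0 : (c : ℂ) * τ₀ + d ≠ 0 := by intro h0; rw [h0] at hJ; simp at hJ
  have hdet' : (a : ℂ) * d - b * c = 1 := by exact_mod_cast hdet
  rw [hτ₁]
  apply mul_right_cancel₀ hJ0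
  rw [inv_mul_cancel₀ hJ0, sub_mul, mul_assoc, div_mul_cancel₀ _ hJ0]
  linear_combination hdet'

theorem add_I_mul_moebiusRoot_sq (hc : 0 < c) (hdet : a * d - b * c = 1) (hτ₀ : 0 < τ₀.im)
    (hτ₁ : τ₁ = (a * τ₀ + b) / (c * τ₀ + d)) {s : ℂ} (hs : 0 < (τ₁ + Complex.I * s ^ 2).im) :
    τ₀ + Complex.I * moebiusRoot a c (c * τ₀ + d) τ₁ s ^ 2 =
      (d * (τ₁ + Complex.I * s ^ 2) - b) / (a - c * (τ₁ + Complex.I * s ^ 2)) := by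
  have hJ := im_int_mul_add hc d hτ₀
  have hJ0 : (c : ℂ) * τ₀ + d ≠ 0 := by intro h0; rw [h0] at hJ; simp at hJ
  have hdet' : (a : ℂ) * d - b * c = 1 := by exact_mod_cast hdet
  have hp := im_sub_int_mul_neg hc a hs
  have hp0 : (a : ℂ) - c * (τ₁ + Complex.I * s ^ 2) ≠ 0 := by intro h; rw [h] at hp; simp at hp
  rw [moebiusRoot, div_pow, mul_pow, csqrt_sq, csqrt_sq, eq_div_iff hp0, add_mul,
    mul_assoc Complex.I, div_mul_cancel₀ _ hp0]
  have h1 : τ₁ * (c * τ₀ + d) = a * τ₀ + b := by rw [hτ₁, div_mul_cancel₀ _ hJ0]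
  linear_combination -h1

/-- In the chain rule, the cube in the denominator cancels the weight 3/2 factor of the unary theta
function, leaving weight 1/2. The root is holomorphic because `a - c w` stays in the lower
half-plane. -/
theorem hasDerivAt_moebiusRoot (hc : 0 < c) (hdet : a * d - b * c = 1) (hτ₀ : 0 < τ₀.im)
    (hτ₁ : τ₁ = (a * τ₀ + b) / (c * τ₀ + d)) {s : ℂ} (hs : 0 < (τ₁ + Complex.I * s ^ 2).im) :
    HasDerivAt (moebiusRoot a c (c * τ₀ + d) τ₁)
      (1 / (csqrt (c * τ₀ + d) * csqrt (a - c * (τ₁ + Complex.I * s ^ 2)) ^ 3)) s := by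
  have hJ := im_int_mul_add hc d hτ₀
  have hJ0 : (c : ℂ) * τ₀ + d ≠ 0 := by intro h0; rw [h0] at hJ; simp at hJ
  have hp := im_sub_int_mul_neg hc a hs
  have hp0 : (a : ℂ) - c * (τ₁ + Complex.I * s ^ 2) ≠ 0 := by intro h; rw [h] at hp; simp at hp
  have hslit : (a : ℂ) - c * (τ₁ + Complex.I * s ^ 2) ∈ Complex.slitPlane :=
    Complex.mem_slitPlane_iff.2 (Or.inr hp.ne)
  have h1 : HasDerivAt (fun s : ℂ => (a : ℂ) - c * (τ₁ + Complex.I * s ^ 2))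
      (-(c * (Complex.I * (2 * s)))) s := by
    refine ((((((hasDerivAt_id s).pow 2).const_mul Complex.I).const_add τ₁).const_mul
      (c : ℂ)).const_sub (a : ℂ)).congr_deriv ?_
    simp
  have h2 := (hasDerivAt_csqrt hslit).comp s h1
  have h3 := ((hasDerivAt_id s).mul_const (csqrt (c * τ₀ + d))).div h2 (csqrt_ne_zero hp0)
  refine h3.congr_deriv ?_
  have hq := csqrt_ne_zero hp0
  have hj := csqrt_ne_zero hJ0
  have hq2 := csqrt_sq (a - c * (τ₁ + Complex.I * s ^ 2))
  have hj2 := csqrt_sq (c * τ₀ + d)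
  have h4 := sub_int_mul_moebius hc hdet hτ₀ hτ₁
  have h5 : ((a : ℂ) - c * τ₁) * csqrt (c * τ₀ + d) ^ 2 = 1 := by
    rw [h4, hj2, inv_mul_cancel₀ hJ0]
  simp only [Function.comp, id]
  generalize csqrt (a - c * (τ₁ + Complex.I * s ^ 2)) = q at *
  generalize csqrt (c * τ₀ + d) = j at *
  field_simp
  linear_combination j ^ 2 * hq2 + h5

/-- Both sides vanish at `s = 0` and have the same derivative in `s`, by the weight 3/2 law. -/
theorem ThetaTransforms.completedFalseTheta_moebius {v : ℂ} (h : ThetaTransforms a b c d v)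
    (hc : 0 < c) (hdet : a * d - b * c = 1) {A₀ B₀ A₁ B₁ : ℝ} (hA : A₀ = c * B₁ + a * A₁)
    (hB : B₀ = d * B₁ + b * A₁) (hτ₀ : 0 < τ₀.im) (hτ₁ : τ₁ = (a * τ₀ + b) / (c * τ₀ + d))
    {s : ℂ} (hs : 0 < (τ₁ + Complex.I * s ^ 2).im) :
    completedFalseTheta A₁ B₁ τ₁ s * Complex.exp (Real.pi * Complex.I * (A₁ * B₁)) =
      v * csqrt (c * τ₀ + d) * Complex.exp (Real.pi * Complex.I * (A₀ * B₀)) *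
        completedFalseTheta A₀ B₀ τ₀ (moebiusRoot a c (c * τ₀ + d) τ₁ s) := by
  have hτ₁im : 0 < τ₁.im := by rw [hτ₁]; exact im_moebius_pos hc hdet hτ₀
  have hJ := im_int_mul_add hc d hτ₀
  have hJ0 : (c : ℂ) * τ₀ + d ≠ 0 := by intro h0; rw [h0] at hJ; simp at hJ
  set P₁ := Complex.exp (Real.pi * Complex.I * (A₁ * B₁)) with hP₁
  set P₀ := Complex.exp (Real.pi * Complex.I * (A₀ * B₀)) with hP₀
  set G : ℂ → ℂ := fun s => completedFalseTheta A₁ B₁ τ₁ s * P₁ -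
    v * csqrt (c * τ₀ + d) * P₀ *
      completedFalseTheta A₀ B₀ τ₀ (moebiusRoot a c (c * τ₀ + d) τ₁ s) with hG
  have hderiv : ∀ s : ℂ, 0 < (τ₁ + Complex.I * s ^ 2).im → HasDerivAt G 0 s := by
    intro s hs
    obtain ⟨e1, e2, e3⟩ := inverse_moebius_identities hc hdet hs
    have hroot := add_I_mul_moebiusRoot_sq hc hdet hτ₀ hτ₁ hs
    have h1 := (hasDerivAt_completedFalseTheta A₁ B₁ hτ₁im hs).mul_const P₁
    have h2 := ((hasDerivAt_completedFalseTheta A₀ B₀ hτ₀ (by rw [hroot]; exact e3)).comp s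
      (hasDerivAt_moebiusRoot hc hdet hτ₀ hτ₁ hs)).const_mul (v * csqrt (c * τ₀ + d) * P₀)
    refine (h1.sub h2).congr_deriv ?_
    rw [hroot]
    have h3 := h.unaryTheta_moebius hc hdet hA hB e3
    have hp := im_sub_int_mul_neg hc a hs
    have hp0 : (a : ℂ) - c * (τ₁ + Complex.I * s ^ 2) ≠ 0 := by intro h; rw [h] at hp; simp at hp
    rw [e2, e1, csqrt_inv (Complex.mem_slitPlane_iff.2 (Or.inr hp.ne))] at h3
    have hq := csqrt_ne_zero hp0
    have hj := csqrt_ne_zero hJ0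
    rw [← hP₁, ← hP₀] at h3
    rw [sub_eq_zero, mul_assoc, h3]
    field_simp
  have hG0 : G 0 = 0 := by
    simp [hG, moebiusRoot, completedFalseTheta_zero]
  -- The domain is star-shaped about `0`, so constancy on the segment from `0` to `s` suffices.
  have hline : ∀ p ∈ Set.Icc (0 : ℝ) 1, 0 < (τ₁ + Complex.I * ((p : ℂ) * s) ^ 2).im := by
    intro p hp
    rw [im_add_I_mul_sq] at hs ⊢
    rw [mul_pow, ← Complex.ofReal_pow, Complex.re_ofReal_mul]
    have : p ^ 2 ≤ 1 := by nlinarith [hp.1, hp.2]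
    rcases le_total 0 (s ^ 2).re with h0 | h0
    · have := mul_nonneg (sq_nonneg p) h0
      linarith
    · nlinarith
  have hconst := (convex_Icc (0 : ℝ) 1).norm_image_sub_le_of_norm_hasDerivWithin_le
    (f := fun p : ℝ => G ((p : ℂ) * s)) (f' := fun _ => 0) (C := 0) (fun p hp => ?_)
    (fun _ _ => by simp) (Set.left_mem_Icc.2 zero_le_one) (Set.right_mem_Icc.2 zero_le_one)
  · rw [zero_mul, norm_le_zero_iff] at hconst
    simp only [Complex.ofReal_one, one_mul, Complex.ofReal_zero, zero_mul, hG0, sub_zero] at hconst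
    exact sub_eq_zero.1 hconst
  · have h1 : HasDerivAt (fun p : ℝ => (p : ℂ) * s) (1 * s) p :=
      (Complex.ofRealCLM.hasDerivAt (x := p)).mul_const s
    have h2 := (hderiv _ (hline p hp)).comp p h1
    rw [zero_mul] at h2
    exact h2.hasDerivWithinAt

end

/-! ### Eichler integrals as values of the completed false theta function -/

/-- The square root of `-i (w - τ)` with branch cut `τ + i [0, ∞)`. -/
def branchRoot (τ w : ℂ) : ℂ := -Complex.I * csqrt (Complex.I * (w - τ))

theorem branchRoot_sq (τ w : ℂ) : branchRoot τ w ^ 2 = -Complex.I * (w - τ) := by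
  rw [branchRoot, mul_pow, csqrt_sq]
  linear_combination (w - τ) * Complex.I * Complex.I_sq

theorem add_I_mul_branchRoot_sq (τ w : ℂ) : τ + Complex.I * branchRoot τ w ^ 2 = w := by
  rw [branchRoot_sq]
  linear_combination -(w - τ) * Complex.I_sq

theorem hasDerivAt_branchRoot {τ w : ℂ} (hw : Complex.I * (w - τ) ∈ Complex.slitPlane) :
    HasDerivAt (branchRoot τ) (1 / (2 * csqrt (Complex.I * (w - τ)))) w := by
  have h1 : HasDerivAt (fun w => Complex.I * (w - τ)) (Complex.I * 1) w :=
    ((hasDerivAt_id w).sub_const τ).const_mul Complex.I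
  refine (((hasDerivAt_csqrt hw).comp w h1).const_mul (-Complex.I)).congr_deriv ?_
  linear_combination -(1 / (2 * csqrt (Complex.I * (w - τ)))) * Complex.I_sq

/-- The completed false theta function with the terms in a finite set removed, as a function of
the elliptic modulus `w`. -/
def truncCompleted (A B : ℝ) (τ : ℂ) (S : Finset ℤ) (w : ℂ) : ℂ :=
  completedFalseTheta A B τ (branchRoot τ w) -
    ∑ n ∈ S, thetaChar A B τ n * cerf (((√Real.pi * (half n + A) : ℝ) : ℂ) * branchRoot τ w)

/-- The integrand of the truncated Eichler integral, written with characteristics. -/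
def eichlerIntegrand (A B : ℝ) (τ : ℂ) (S : Finset ℤ) (w : ℂ) : ℂ :=
  (∑' n : ((↑S : Set ℤ)ᶜ : Set ℤ), ((half n + A : ℝ) : ℂ) * thetaChar A B w n) /
    csqrt (Complex.I * (w - τ))

theorem tsum_compl_eq_unaryTheta_sub (A B : ℝ) (S : Finset ℤ) {w : ℂ} (hw : 0 < w.im) :
    ∑' n : ((↑S : Set ℤ)ᶜ : Set ℤ), ((half n + A : ℝ) : ℂ) * thetaChar A B w n =
      unaryTheta A B w - ∑ n ∈ S, ((half n + A : ℝ) : ℂ) * thetaChar A B w n := by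
  rw [unaryTheta, ← (summable_mul_thetaChar A B hw).sum_add_tsum_compl (s := S), add_sub_cancel_left]

/-- With `s = branchRoot τ w` one has `τ + i s² = w` and `ds/dw = 1 / (2 √(i(w - τ)))`, which
cancels the factor 2 of the `s`-derivative. The omitted terms are differentiated one by one. -/
theorem hasDerivAt_truncCompleted (A B : ℝ) (S : Finset ℤ) {τ w : ℂ} (hτ : 0 < τ.im)
    (hw : 0 < w.im) (hslit : Complex.I * (w - τ) ∈ Complex.slitPlane) :
    HasDerivAt (truncCompleted A B τ S) (eichlerIntegrand A B τ S w) w := by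
  have hb := add_I_mul_branchRoot_sq τ w
  have h1 := (hasDerivAt_completedFalseTheta A B hτ (s := branchRoot τ w)
    (by rwa [hb])).comp w (hasDerivAt_branchRoot hslit)
  have h2 := HasDerivAt.fun_sum (u := S) fun n _ =>
    (hasDerivAt_thetaChar_mul_cerf A B τ (branchRoot τ w) n).comp w (hasDerivAt_branchRoot hslit)
  refine (h1.sub h2).congr_deriv ?_
  have h0 := csqrt_ne_zero (Complex.slitPlane_ne_zero hslit)
  rw [eichlerIntegrand, tsum_compl_eq_unaryTheta_sub A B S hw, hb, ← Finset.sum_mul,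
    ← Finset.mul_sum]
  field_simp

theorem continuousAt_unaryTheta (A B : ℝ) {w : ℂ} (hw : 0 < w.im) :
    ContinuousAt (unaryTheta A B) w := by
  have hopen : IsOpen {w' : ℂ | w.im / 2 < w'.im} :=
    isOpen_lt continuous_const Complex.continuous_im
  refine ContinuousOn.continuousAt (s := {w' : ℂ | w.im / 2 < w'.im}) ?_
    (hopen.mem_nhds (by change w.im / 2 < w.im; linarith))
  refine continuousOn_tsum (fun n => ?_) (summable_abs_mul_gaussian A (half_pos hw)) ?_
  · unfold thetaChar
    fun_prop
  · intro n w' hw'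
    rw [norm_mul_thetaChar]
    gcongr
    exact (show w.im / 2 < w'.im from hw').le

theorem continuous_thetaChar (A B : ℝ) (n : ℤ) : Continuous fun w => thetaChar A B w n := by
  unfold thetaChar
  fun_prop

theorem continuousAt_csqrt {w : ℂ} (hw : w ∈ Complex.slitPlane) : ContinuousAt csqrt w :=
  (hasDerivAt_csqrt hw).continuousAt

theorem continuousAt_csqrt_I_mul {τ w : ℂ} (hw : Complex.I * (w - τ) ∈ Complex.slitPlane) :
    ContinuousAt (fun w => csqrt (Complex.I * (w - τ))) w :=
  ContinuousAt.comp (f := fun w => Complex.I * (w - τ)) (continuousAt_csqrt hw) (by fun_prop)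

theorem continuousAt_eichlerIntegrand (A B : ℝ) (S : Finset ℤ) {τ w : ℂ} (hw : 0 < w.im)
    (hslit : Complex.I * (w - τ) ∈ Complex.slitPlane) :
    ContinuousAt (eichlerIntegrand A B τ S) w := by
  have h1 : ContinuousAt (fun w => (unaryTheta A B w -
      ∑ n ∈ S, ((half n + A : ℝ) : ℂ) * thetaChar A B w n) / csqrt (Complex.I * (w - τ))) w := by
    refine ContinuousAt.div ((continuousAt_unaryTheta A B hw).sub ?_) (continuousAt_csqrt_I_mul hslit)
      (csqrt_ne_zero (Complex.slitPlane_ne_zero hslit))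
    exact (continuous_finsetSum _ fun n _ =>
      continuous_const.mul (continuous_thetaChar A B n)).continuousAt
  refine h1.congr ?_
  have hopen : IsOpen {w' : ℂ | 0 < w'.im} := isOpen_lt continuous_const Complex.continuous_im
  filter_upwards [hopen.mem_nhds hw] with w' hw'
  rw [eichlerIntegrand, tsum_compl_eq_unaryTheta_sub A B S hw']

/-! #### The vertical half-line -/

theorem im_pathRay {τ : ℂ} {ε t : ℝ} : (pathRay τ ε t).im = τ.im + t := by
  simp [pathRay]

theorem I_mul_pathRay_sub (τ : ℂ) (ε t : ℝ) :
    Complex.I * (pathRay τ ε t - τ) = -t + ε * Complex.I := by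
  rw [pathRay]
  linear_combination (t : ℂ) * Complex.I_sq

theorem I_mul_pathRay_sub_mem (τ : ℂ) {ε : ℝ} (hε : 0 < ε) (t : ℝ) :
    Complex.I * (pathRay τ ε t - τ) ∈ Complex.slitPlane := by
  rw [I_mul_pathRay_sub]
  exact Complex.mem_slitPlane_iff.2 (Or.inr (by simpa using hε.ne'))

theorem hasDerivAt_pathRay (τ : ℂ) (ε t : ℝ) : HasDerivAt (pathRay τ ε) Complex.I t := by
  have := (((Complex.ofRealCLM.hasDerivAt (x := t)).const_mul Complex.I).const_add (τ + ε))
  refine this.congr_deriv ?_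
  simp

theorem continuous_pathRay (τ : ℂ) (ε : ℝ) : Continuous (pathRay τ ε) := by
  unfold pathRay; fun_prop

/-- A possible term with `m + A = 0` vanishes, so the numerator decays exponentially, and the
denominator is at least `√ε` in modulus. -/
theorem integrableOn_eichlerIntegrand_pathRay (A B : ℝ) (S : Finset ℤ) {τ : ℂ} (hτ : 0 < τ.im)
    {ε : ℝ} (hε : 0 < ε) :
    IntegrableOn (fun t : ℝ => eichlerIntegrand A B τ S (pathRay τ ε t)) (Set.Ioi 0) := by
  obtain ⟨δ, hδ, C, hC⟩ := exists_norm_tsum_mul_thetaChar_le A B hτ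
  have hcont : ContinuousOn (fun t : ℝ => eichlerIntegrand A B τ S (pathRay τ ε t)) (Set.Ioi 0) := by
    intro t ht
    refine (ContinuousAt.comp (f := pathRay τ ε) (continuousAt_eichlerIntegrand A B S ?_
      (I_mul_pathRay_sub_mem τ hε t)) (continuous_pathRay τ ε).continuousAt).continuousWithinAt
    rw [im_pathRay]
    exact add_pos hτ ht
  have hdom : IntegrableOn (fun t : ℝ => C * Real.exp (-δ * τ.im) / √ε * Real.exp (-δ * t))
      (Set.Ioi 0) := (exp_neg_integrableOn_Ioi 0 hδ).const_mul _
  refine hdom.mono' (hcont.aestronglyMeasurable measurableSet_Ioi) ?_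
  refine (ae_restrict_iff' measurableSet_Ioi).2 (Eventually.of_forall fun t ht => ?_)
  have h1 := hC (↑S : Set ℤ)ᶜ (pathRay τ ε t) (by rw [im_pathRay]; linarith [Set.mem_Ioi.1 ht])
  rw [eichlerIntegrand, norm_div]
  have h2 : √ε ≤ ‖csqrt (Complex.I * (pathRay τ ε t - τ))‖ := by
    refine (Real.sqrt_le_left (norm_nonneg _)).2 ?_
    rw [← norm_pow, csqrt_sq, I_mul_pathRay_sub]
    refine le_trans (le_of_eq ?_) (Complex.abs_im_le_norm _)
    simp [abs_of_pos hε]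
  rw [im_pathRay, mul_add, Real.exp_add, ← mul_assoc] at h1
  have hsq : 0 < √ε := by positivity
  calc _ ≤ C * Real.exp (-δ * τ.im) * Real.exp (-δ * t) / √ε := by
        have := (norm_nonneg _).trans h1
        gcongr
    _ = _ := by ring

/-- On the ray `s² = t - iε`. Passing to the right of the cut gives `Re s > 0`, hence the limit
`+sgn`. -/
theorem tendsto_truncCompleted_pathRay (A B : ℝ) (S : Finset ℤ) {τ : ℂ} (hτ : 0 < τ.im)
    {ε : ℝ} (hε : 0 < ε) :
    Tendsto (fun t : ℝ => truncCompleted A B τ S (pathRay τ ε t)) atTop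
      (𝓝 (∑' n : ((↑S : Set ℤ)ᶜ : Set ℤ), (Real.sign (half n + A) : ℂ) * thetaChar A B τ n)) := by
  have hs : ∀ᶠ t : ℝ in atTop, 0 < (branchRoot τ (pathRay τ ε t)).re := by
    refine Eventually.of_forall fun t => ?_
    have : 0 < (csqrt (Complex.I * (pathRay τ ε t - τ))).im :=
      csqrt_im_pos (by rw [I_mul_pathRay_sub]; simpa using hε)
    simpa [branchRoot] using this
  have hs2 : Tendsto (fun t : ℝ => (branchRoot τ (pathRay τ ε t) ^ 2).re) atTop atTop := by
    have : (fun t : ℝ => (branchRoot τ (pathRay τ ε t) ^ 2).re) = id := by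
      ext t
      rw [branchRoot_sq, neg_mul, I_mul_pathRay_sub]
      simp
    rw [this]
    exact tendsto_id
  have h1 := tendsto_completedFalseTheta A B hτ hs hs2
  have h2 : Tendsto (fun t : ℝ => ∑ n ∈ S, thetaChar A B τ n *
      cerf (((√Real.pi * (half n + A) : ℝ) : ℂ) * branchRoot τ (pathRay τ ε t))) atTop
      (𝓝 (∑ n ∈ S, (Real.sign (half n + A) : ℂ) * thetaChar A B τ n)) := by
    refine tendsto_finsetSum _ fun n _ => ?_
    have := (tendsto_cerf_mul hs hs2 (√Real.pi * (half n + A))).const_mul (thetaChar A B τ n)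
    rwa [sign_sqrt_pi_mul, mul_comm (thetaChar A B τ n)] at this
  have h3 := h1.sub h2
  rwa [← (summable_sign_mul_thetaChar A B hτ).sum_add_tsum_compl (s := S), add_sub_cancel_left]
    at h3

theorem integral_eichlerIntegrand_pathRay (A B : ℝ) (S : Finset ℤ) {τ : ℂ} (hτ : 0 < τ.im)
    {ε : ℝ} (hε : 0 < ε) :
    ∫ t in Set.Ioi (0 : ℝ), eichlerIntegrand A B τ S (pathRay τ ε t) * Complex.I =
      (∑' n : ((↑S : Set ℤ)ᶜ : Set ℤ), (Real.sign (half n + A) : ℂ) * thetaChar A B τ n) -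
        truncCompleted A B τ S (τ + ε) := by
  have h := integral_Ioi_of_hasDerivAt_of_tendsto' (a := 0)
    (f := fun t : ℝ => truncCompleted A B τ S (pathRay τ ε t))
    (f' := fun t : ℝ => eichlerIntegrand A B τ S (pathRay τ ε t) * Complex.I) (fun t ht => ?_)
    ((integrableOn_eichlerIntegrand_pathRay A B S hτ hε).mul_const Complex.I)
    (tendsto_truncCompleted_pathRay A B S hτ hε)
  · rw [h]
    simp [pathRay]
  · refine (hasDerivAt_truncCompleted A B S hτ ?_ (I_mul_pathRay_sub_mem τ hε t)).comp t
      (hasDerivAt_pathRay τ ε t)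
    rw [im_pathRay]
    exact add_pos_of_pos_of_nonneg hτ ht

/-! #### The segment starting at a cusp -/

theorem im_pathSegment (r : ℝ) (τ : ℂ) (ε t : ℝ) : (pathSegment r τ ε t).im = t * τ.im := by
  simp [pathSegment]

theorem I_mul_pathSegment_sub_mem (r : ℝ) {τ : ℂ} (hτ : 0 < τ.im) {ε : ℝ} (hε : 0 < ε) {t : ℝ}
    (ht : t ≤ 1) : Complex.I * (pathSegment r τ ε t - τ) ∈ Complex.slitPlane := by
  have h1 : (Complex.I * (pathSegment r τ ε t - τ)).re = (1 - t) * τ.im := by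
    simp [pathSegment]; ring
  rcases ht.lt_or_eq with h | rfl
  · refine Complex.mem_slitPlane_iff.2 (Or.inl ?_)
    rw [h1]
    exact mul_pos (by linarith) hτ
  · refine Complex.mem_slitPlane_iff.2 (Or.inr ?_)
    simp [pathSegment, hε.ne']

theorem hasDerivAt_pathSegment (r : ℝ) (τ : ℂ) (ε t : ℝ) :
    HasDerivAt (pathSegment r τ ε) (τ + ε - r) t := by
  have := ((Complex.ofRealCLM.hasDerivAt (x := t)).mul_const (τ + ε - r : ℂ)).const_add (r : ℂ)
  refine this.congr_deriv ?_
  simp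

theorem continuous_pathSegment (r : ℝ) (τ : ℂ) (ε : ℝ) : Continuous (pathSegment r τ ε) := by
  unfold pathSegment; fun_prop

theorem integrableOn_Ioc_of_continuousOn_of_tendsto {f : ℝ → ℂ} {L : ℂ} {a b : ℝ}
    (hab : a < b) (hf : ContinuousOn f (Set.Ioc a b)) (hl : Tendsto f (𝓝[>] a) (𝓝 L)) :
    IntegrableOn f (Set.Ioc a b) := by
  have h1 : ContinuousOn (Function.update f a L) (Set.Icc a b) := by
    rw [continuousOn_update_iff]
    refine ⟨?_, fun _ => ?_⟩
    · rwa [Set.Icc_sdiff_left]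
    · rw [Set.Icc_sdiff_left, nhdsWithin_Ioc_eq_nhdsGT hab]
      exact hl
  refine ((h1.integrableOn_Icc).mono_set Set.Ioc_subset_Icc_self).congr_fun ?_ measurableSet_Ioc
  intro x hx
  exact Function.update_of_ne hx.1.ne' _ _

section
variable {a b c d : ℤ} {τ₀ τ₁ v : ℂ} {ε : ℝ}

theorem im_segment_direction (τ : ℂ) (ε r : ℝ) : (τ + ε - r : ℂ).im = τ.im := by simp

theorem sub_int_mul_pathSegment (hc : 0 < c) (τ : ℂ) (ε t : ℝ) :
    (a : ℂ) - c * pathSegment (a / c : ℝ) τ ε t = -(c * t * (τ + ε - (a / c : ℝ))) := by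
  have hc0 : (c : ℂ) ≠ 0 := by exact_mod_cast hc.ne'
  rw [pathSegment]
  push_cast
  field_simp
  ring

/-- The segment leaves the cusp `a/c = γ(∞)`, so `γ⁻¹` maps it into a straight line, on which the
imaginary part grows like `1/t` as `t → 0`. -/
theorem inverse_moebius_pathSegment (hc : 0 < c) (hdet : a * d - b * c = 1) (hτ : 0 < τ₁.im)
    {t : ℝ} (ht : 0 < t) :
    (d * pathSegment (a / c : ℝ) τ₁ ε t - b) / (a - c * pathSegment (a / c : ℝ) τ₁ ε t) =
      ((-(d / c) : ℝ) : ℂ) + ((t⁻¹ / c ^ 2 : ℝ) : ℂ) * (-1 / (τ₁ + ε - (a / c : ℝ))) := by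
  have hc0 : (c : ℂ) ≠ 0 := by exact_mod_cast hc.ne'
  have hw : 0 < (pathSegment (a / c : ℝ) τ₁ ε t).im := by rw [im_pathSegment]; positivity
  obtain ⟨h1, -, -⟩ := inverse_moebius_identities hc hdet hw
  rw [sub_int_mul_pathSegment hc] at h1 ⊢
  have hδ0 : (τ₁ + ε - (a / c : ℝ) : ℂ) ≠ 0 := by
    intro h
    rw [← im_segment_direction τ₁ ε (a / c : ℝ), h] at hτ
    simp at hτ
  have ht0 : (t : ℂ) ≠ 0 := by exact_mod_cast ht.ne'
  apply mul_left_cancel₀ hc0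
  rw [eq_sub_of_add_eq h1]
  generalize (τ₁ + ε - (a / c : ℝ) : ℂ) = δ at *
  push_cast
  field_simp
  ring

theorem im_inverse_moebius_pathSegment (hc : 0 < c) (hdet : a * d - b * c = 1) (hτ : 0 < τ₁.im)
    {t : ℝ} (ht : 0 < t) :
    ((d * pathSegment (a / c : ℝ) τ₁ ε t - b) / (a - c * pathSegment (a / c : ℝ) τ₁ ε t) : ℂ).im =
      (-1 / (τ₁ + ε - (a / c : ℝ)) : ℂ).im / c ^ 2 * t⁻¹ := by
  rw [inverse_moebius_pathSegment hc hdet hτ ht, Complex.add_im, Complex.ofReal_im, zero_add,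
    Complex.im_ofReal_mul]
  ring

theorem im_cusp_rate_pos (hc : 0 < c) (hτ : 0 < τ₁.im) (ε r : ℝ) :
    0 < (-1 / (τ₁ + ε - r) : ℂ).im / (c : ℝ) ^ 2 := by
  have : (0 : ℝ) < c := by exact_mod_cast hc
  exact div_pos (im_neg_one_div (by rwa [im_segment_direction])) (by positivity)

/-- Rounds the exponent 3/2 up to 2, so that the limit of `x² exp(-x)` can be used at the cusp. -/
theorem norm_csqrt_pow_three_le {u : ℂ} (hu : 1 ≤ ‖u‖) : ‖csqrt u ^ 3‖ ≤ ‖u‖ ^ 2 := by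
  have h1 : ‖csqrt u‖ ^ 2 = ‖u‖ := by rw [← norm_pow, csqrt_sq]
  have h2 : 1 ≤ ‖csqrt u‖ := by
    by_contra! h
    nlinarith [norm_nonneg (csqrt u)]
  rw [norm_pow, ← h1, ← pow_mul]
  exact pow_le_pow_right₀ h2 (by norm_num)

/-- Modularity moves the cusp to `i∞`, where exponential decay in `1/t` beats the automorphy factor
of order `t^(-3/2)`. -/
theorem ThetaTransforms.tendsto_unaryTheta_cusp (h : ThetaTransforms a b c d v) (hc : 0 < c)
    (hdet : a * d - b * c = 1) {A₀ B₀ A₁ B₁ : ℝ} (hA : A₀ = c * B₁ + a * A₁)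
    (hB : B₀ = d * B₁ + b * A₁) (hτ₁ : 0 < τ₁.im) :
    Tendsto (fun t : ℝ => unaryTheta A₁ B₁ (pathSegment (a / c : ℝ) τ₁ ε t)) (𝓝[>] 0)
      (𝓝 0) := by
  obtain ⟨κ, hκ, C, hC⟩ := exists_norm_tsum_mul_thetaChar_le A₀ B₀ one_pos
  set δ : ℂ := τ₁ + ε - (a / c : ℝ) with hδ
  have hδ0 : δ ≠ 0 := by
    intro h
    rw [← im_segment_direction τ₁ ε (a / c : ℝ), ← hδ, h] at hτ₁
    simp at hτ₁
  have hη := im_cusp_rate_pos hc hτ₁ ε (a / c : ℝ)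
  rw [← hδ] at hη
  set η := (-1 / δ).im / (c : ℝ) ^ 2 with hηdef
  have hcR : (0 : ℝ) < c := by exact_mod_cast hc
  set m : ℝ := (c * ‖δ‖)⁻¹ with hm
  have hmpos : 0 < m := by have := norm_pos_iff.2 hδ0; positivity
  set P₁ := Complex.exp (Real.pi * Complex.I * (A₁ * B₁)) with hP₁
  set P₀ := Complex.exp (Real.pi * Complex.I * (A₀ * B₀)) with hP₀
  have hP₁0 : P₁ ≠ 0 := Complex.exp_ne_zero _
  have hinv : Tendsto (fun t : ℝ => t⁻¹) (𝓝[>] 0) atTop := tendsto_inv_nhdsGT_zero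
  have hlim : Tendsto (fun t : ℝ => ‖v‖ * ‖P₀‖ * m ^ 2 * C / ‖P₁‖ / (κ * η) ^ 2 *
      ((κ * η * t⁻¹) ^ 2 * Real.exp (-(κ * η * t⁻¹)))) (𝓝[>] 0) (𝓝 0) := by
    have := ((Real.tendsto_pow_mul_exp_neg_atTop_nhds_zero 2).comp
      (hinv.const_mul_atTop (mul_pos hκ hη))).const_mul
      (‖v‖ * ‖P₀‖ * m ^ 2 * C / ‖P₁‖ / (κ * η) ^ 2)
    rw [mul_zero] at this
    exact this
  refine squeeze_zero_norm' ?_ hlim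
  filter_upwards [self_mem_nhdsWithin, (hinv.const_mul_atTop hη).eventually_ge_atTop 1,
    (hinv.const_mul_atTop hmpos).eventually_ge_atTop 1] with t ht h1 h2
  have ht0 : 0 < t := ht
  have hw : 0 < (pathSegment (a / c : ℝ) τ₁ ε t).im := by rw [im_pathSegment]; positivity
  obtain ⟨e1, e2, e3⟩ := inverse_moebius_identities hc hdet hw
  have him := im_inverse_moebius_pathSegment (ε := ε) hc hdet hτ₁ ht0
  rw [← hδ, ← hηdef] at him
  have key := h.unaryTheta_moebius hc hdet hA hB e3
  rw [e2, e1] at key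
  have hnorm : ‖((a : ℂ) - c * pathSegment (a / c : ℝ) τ₁ ε t)⁻¹‖ = m * t⁻¹ := by
    rw [sub_int_mul_pathSegment hc, ← hδ, norm_inv, norm_neg, norm_mul, norm_mul, Complex.norm_real,
      Real.norm_of_nonneg ht0.le, Complex.norm_intCast, abs_of_pos hcR, hm, ← mul_inv]
    ring
  have hs := norm_csqrt_pow_three_le (u := ((a : ℂ) - c * pathSegment (a / c : ℝ) τ₁ ε t)⁻¹)
    (by rw [hnorm]; exact h2)
  rw [hnorm] at hs
  have hU := hC Set.univ _ (by rw [him]; exact h1)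
  rw [tsum_univ (fun n => ((half n + A₀ : ℝ) : ℂ) * thetaChar A₀ B₀ _ n), him] at hU
  have hkey := congrArg norm (eq_div_of_mul_eq hP₁0 key)
  rw [hkey, norm_div, norm_mul, norm_mul, norm_mul, ← hP₀]
  calc _ ≤ ‖v‖ * (m * t⁻¹) ^ 2 * ‖P₀‖ * (C * Real.exp (-κ * (η * t⁻¹))) / ‖P₁‖ := by
        gcongr
        exact hU
    _ = _ := by
        rw [show -κ * (η * t⁻¹) = -(κ * η * t⁻¹) by ring]
        field_simp

/-- At the cusp the full theta function tends to 0 and the finitely many omitted terms are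
continuous there, so the integrand has a limit as `t → 0`. -/
theorem ThetaTransforms.integrableOn_eichlerIntegrand_pathSegment (h : ThetaTransforms a b c d v)
    (hc : 0 < c) (hdet : a * d - b * c = 1) {A₀ B₀ A₁ B₁ : ℝ} (hA : A₀ = c * B₁ + a * A₁)
    (hB : B₀ = d * B₁ + b * A₁) (hτ₁ : 0 < τ₁.im) (hε : 0 < ε) (S : Finset ℤ) :
    IntegrableOn (fun t : ℝ => eichlerIntegrand A₁ B₁ τ₁ S (pathSegment (a / c : ℝ) τ₁ ε t))
      (Set.Ioc 0 1) := by
  set r : ℝ := a / c with hr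
  have hp := continuous_pathSegment r τ₁ ε
  have hl : Tendsto (fun t : ℝ => eichlerIntegrand A₁ B₁ τ₁ S (pathSegment r τ₁ ε t)) (𝓝[>] 0)
      (𝓝 ((0 - ∑ n ∈ S, ((half n + A₁ : ℝ) : ℂ) * thetaChar A₁ B₁ (pathSegment r τ₁ ε 0) n) /
        csqrt (Complex.I * (pathSegment r τ₁ ε 0 - τ₁)))) := by
    have hslit := I_mul_pathSegment_sub_mem r hτ₁ hε zero_le_one
    have h1 : Tendsto (fun t : ℝ => (unaryTheta A₁ B₁ (pathSegment r τ₁ ε t) -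
        ∑ n ∈ S, ((half n + A₁ : ℝ) : ℂ) * thetaChar A₁ B₁ (pathSegment r τ₁ ε t) n) /
        csqrt (Complex.I * (pathSegment r τ₁ ε t - τ₁))) (𝓝[>] 0)
        (𝓝 ((0 - ∑ n ∈ S, ((half n + A₁ : ℝ) : ℂ) * thetaChar A₁ B₁ (pathSegment r τ₁ ε 0) n) /
          csqrt (Complex.I * (pathSegment r τ₁ ε 0 - τ₁)))) := by
      refine Tendsto.div ((h.tendsto_unaryTheta_cusp hc hdet hA hB hτ₁).sub ?_) ?_
        (csqrt_ne_zero (Complex.slitPlane_ne_zero hslit))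
      · exact ((continuous_finsetSum _ fun n _ => continuous_const.mul
          ((continuous_thetaChar A₁ B₁ n).comp hp)).tendsto 0).mono_left nhdsWithin_le_nhds
      · exact (ContinuousAt.comp (f := pathSegment r τ₁ ε) (continuousAt_csqrt_I_mul hslit)
          hp.continuousAt).tendsto.mono_left nhdsWithin_le_nhds
    refine h1.congr' ?_
    filter_upwards [self_mem_nhdsWithin] with t ht
    have ht0 : 0 < t := ht
    rw [eichlerIntegrand, tsum_compl_eq_unaryTheta_sub A₁ B₁ S
      (by rw [im_pathSegment]; positivity)]
  refine integrableOn_Ioc_of_continuousOn_of_tendsto one_pos (fun t ht => ?_) hl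
  refine (ContinuousAt.comp (f := pathSegment r τ₁ ε) (continuousAt_eichlerIntegrand A₁ B₁ S ?_
    (I_mul_pathSegment_sub_mem r hτ₁ hε ht.2)) hp.continuousAt).continuousWithinAt
  rw [im_pathSegment]
  exact mul_pos ht.1 hτ₁

theorem csqrt_im_neg {w : ℂ} (hw : w.im < 0) : (csqrt w).im < 0 := by
  have h1 := csqrt_re_pos (Complex.mem_slitPlane_iff.2 (Or.inr hw.ne))
  have h2 := congrArg Complex.im (csqrt_sq w)
  rw [sq, Complex.mul_im] at h2
  by_contra! h
  nlinarith

theorem csqrt_ofReal_mul {x : ℝ} (hx : 0 < x) {w : ℂ} (hw : w ∈ Complex.slitPlane) :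
    csqrt (x * w) = (√x : ℝ) * csqrt w := by
  refine csqrt_eq_of_sq ?_ ?_
  · rw [mul_pow, csqrt_sq, ← Complex.ofReal_pow, Real.sq_sqrt hx.le]
  · rw [Complex.re_ofReal_mul]
    exact mul_pos (Real.sqrt_pos.2 hx) (csqrt_re_pos hw)

theorem csqrt_I_div {x : ℝ} (hx : 0 < x) {J : ℂ} (hJ : 0 < J.im) :
    csqrt (Complex.I / (x * J)) = (zetaEight⁻¹ * csqrt J * (√x : ℝ))⁻¹ := by
  have hx2 : ((√x : ℝ) : ℂ) ^ 2 = x := by rw [← Complex.ofReal_pow, Real.sq_sqrt hx.le]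
  refine csqrt_eq_of_sq ?_ (inv_re_pos ?_)
  · rw [inv_pow, mul_pow, mul_pow, csqrt_sq, inv_pow, zetaEight_sq, hx2, Complex.inv_I,
      ← Complex.inv_I, mul_assoc, mul_inv, inv_inv, mul_comm J, div_eq_mul_inv]
  · exact zetaEight_mul_mul_re_pos (csqrt_re_pos (Complex.mem_slitPlane_iff.2 (Or.inr hJ.ne')))
      (csqrt_im_pos hJ) (by simpa using hx)

theorem tendsto_re_moebiusRoot_sq (hc : 0 < c) (hdet : a * d - b * c = 1) (hτ₀ : 0 < τ₀.im)
    (hτ₁ : τ₁ = (a * τ₀ + b) / (c * τ₀ + d)) :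
    Tendsto (fun t : ℝ => (moebiusRoot a c (c * τ₀ + d) τ₁
      (branchRoot τ₁ (pathSegment (a / c : ℝ) τ₁ ε t)) ^ 2).re) (𝓝[>] 0) atTop := by
  have hτ₁im : 0 < τ₁.im := by rw [hτ₁]; exact im_moebius_pos hc hdet hτ₀
  have hη := im_cusp_rate_pos hc hτ₁im ε (a / c : ℝ)
  have h1 : Tendsto (fun t : ℝ => (-1 / (τ₁ + ε - (a / c : ℝ)) : ℂ).im / (c : ℝ) ^ 2 * t⁻¹ - τ₀.im)
      (𝓝[>] 0) atTop :=
    tendsto_atTop_add_const_right _ _ (tendsto_inv_nhdsGT_zero.const_mul_atTop hη)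
  refine h1.congr' ?_
  filter_upwards [self_mem_nhdsWithin] with t ht
  have ht0 : 0 < t := ht
  have hw : 0 < (pathSegment (a / c : ℝ) τ₁ ε t).im := by rw [im_pathSegment]; positivity
  have hb := add_I_mul_branchRoot_sq τ₁ (pathSegment (a / c : ℝ) τ₁ ε t)
  have h2 := congrArg Complex.im (add_I_mul_moebiusRoot_sq hc hdet hτ₀ hτ₁
    (s := branchRoot τ₁ (pathSegment (a / c : ℝ) τ₁ ε t)) (by rwa [hb]))
  rw [hb, im_add_I_mul_sq, im_inverse_moebius_pathSegment hc hdet hτ₁im ht0] at h2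
  linarith

/-- This decides the sign: the limit at the cusp is `+sgn` and not `-sgn`. Up to the positive factor
`1/√t` the root is continuous at `t = 0`, so its value there decides. -/
theorem eventually_re_moebiusRoot_pos (hc : 0 < c) (hdet : a * d - b * c = 1) (hτ₀ : 0 < τ₀.im)
    (hτ₁ : τ₁ = (a * τ₀ + b) / (c * τ₀ + d)) (hε : 0 < ε) :
    ∀ᶠ t : ℝ in 𝓝[>] 0, 0 < (moebiusRoot a c (c * τ₀ + d) τ₁
      (branchRoot τ₁ (pathSegment (a / c : ℝ) τ₁ ε t))).re := by
  have hτ₁im : 0 < τ₁.im := by rw [hτ₁]; exact im_moebius_pos hc hdet hτ₀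
  have hJ := im_int_mul_add hc d hτ₀
  have hJ0 : (c : ℂ) * τ₀ + d ≠ 0 := by intro h0; rw [h0] at hJ; simp at hJ
  have hcR : (0 : ℝ) < c := by exact_mod_cast hc
  have hc0 : (c : ℂ) ≠ 0 := by exact_mod_cast hc.ne'
  have hcc := sub_int_mul_moebius hc hdet hτ₀ hτ₁
  set r : ℝ := a / c with hr
  set J : ℂ := c * τ₀ + d with hJdef
  set u : ℂ := -(c * (τ₁ + ε - r)) with hu
  have huim : u.im < 0 := by
    have : u.im = -(c * τ₁.im) := by simp [hu]
    rw [this]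
    nlinarith [mul_pos hcR hτ₁im]
  have huslit : u ∈ Complex.slitPlane := Complex.mem_slitPlane_iff.2 (Or.inr huim.ne)
  have hslit := I_mul_pathSegment_sub_mem r hτ₁im hε zero_le_one
  have hlim : Tendsto (fun t : ℝ => (branchRoot τ₁ (pathSegment r τ₁ ε t) * csqrt J / csqrt u).re)
      (𝓝[>] 0) (𝓝 (branchRoot τ₁ (pathSegment r τ₁ ε 0) * csqrt J / csqrt u).re) := by
    have h1 : ContinuousAt (fun t : ℝ => branchRoot τ₁ (pathSegment r τ₁ ε t)) 0 :=
      ContinuousAt.comp (f := pathSegment r τ₁ ε) (hasDerivAt_branchRoot hslit).continuousAt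
        (continuous_pathSegment r τ₁ ε).continuousAt
    exact (Complex.continuous_re.continuousAt.comp
      ((h1.mul_const (csqrt J)).div_const (csqrt u))).tendsto.mono_left nhdsWithin_le_nhds
  have hval : 0 < (branchRoot τ₁ (pathSegment r τ₁ ε 0) * csqrt J / csqrt u).re := by
    have h1 : Complex.I * (pathSegment r τ₁ ε 0 - τ₁) = Complex.I / ((c : ℝ) * J) := by
      have h2 : (c : ℂ) * (r - τ₁) = J⁻¹ := by
        rw [← hcc, hr]
        push_cast
        field_simp
      rw [pathSegment, Complex.ofReal_zero, zero_mul, add_zero]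
      rw [div_eq_mul_inv, mul_inv, ← h2]
      push_cast
      field_simp
    have hj := csqrt_ne_zero hJ0
    have hsc : ((√(c : ℝ) : ℝ) : ℂ) ≠ 0 := by
      rw [Complex.ofReal_ne_zero]; positivity
    -- The root of `J` cancels. As `u` lies in the lower half-plane, `1/√u` lies in the first
    -- quadrant, and `ζ₈⁻¹` turns it into the right half-plane.
    have h3 : branchRoot τ₁ (pathSegment r τ₁ ε 0) * csqrt J / csqrt u =
        (((√(c : ℝ))⁻¹ : ℝ) : ℂ) * (zetaEight⁻¹ * (csqrt u)⁻¹ * 1) := by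
      rw [branchRoot, h1, csqrt_I_div hcR hJ]
      have h4 : -Complex.I * zetaEight = zetaEight⁻¹ := by
        refine eq_inv_of_mul_eq_one_left ?_
        rw [mul_assoc, ← sq, zetaEight_sq]
        linear_combination -Complex.I_sq
      rw [mul_inv, mul_inv, inv_inv, ← h4]
      push_cast
      field_simp
    rw [h3, Complex.re_ofReal_mul]
    have h5 := csqrt_re_pos huslit
    refine mul_pos (by positivity) (zetaEight_mul_mul_re_pos (inv_re_pos h5) ?_ (by simp))
    rw [Complex.inv_im]
    exact div_pos (neg_pos.2 (csqrt_im_neg huim)) (Complex.normSq_pos.2 (by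
      intro h; rw [h] at h5; simp at h5))
  filter_upwards [self_mem_nhdsWithin, hlim.eventually_const_lt hval] with t ht hpos
  have ht0 : 0 < t := ht
  rw [moebiusRoot, add_I_mul_branchRoot_sq, hr, sub_int_mul_pathSegment hc, ← hr,
    show -(c * t * (τ₁ + ε - r) : ℂ) = t * u by rw [hu]; ring, csqrt_ofReal_mul ht0 huslit]
  rw [show branchRoot τ₁ (pathSegment r τ₁ ε t) * csqrt J / ((√t : ℝ) * csqrt u) =
    (((√t)⁻¹ : ℝ) : ℂ) * (branchRoot τ₁ (pathSegment r τ₁ ε t) * csqrt J / csqrt u) by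
      push_cast
      field_simp, Complex.re_ofReal_mul]
  exact mul_pos (by positivity) hpos

/-- The false theta function at `τ₀` in terms of the Eichler integral at `γ τ₀`. -/
theorem ThetaTransforms.falseTheta (h : ThetaTransforms a b c d v)
    (hc : 0 < c) (hdet : a * d - b * c = 1) {A₀ B₀ A₁ B₁ : ℝ} (hA : A₀ = c * B₁ + a * A₁)
    (hB : B₀ = d * B₁ + b * A₁) (hτ₀ : 0 < τ₀.im) (hτ₁ : τ₁ = (a * τ₀ + b) / (c * τ₀ + d))
    (hε : 0 < ε) (S : Finset ℤ) :
    v * csqrt (c * τ₀ + d) * Complex.exp (Real.pi * Complex.I * (A₀ * B₀)) *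
        ∑' n, (Real.sign (half n + A₀) : ℂ) * thetaChar A₀ B₀ τ₀ n =
      ((∑' n : ((↑S : Set ℤ)ᶜ : Set ℤ), (Real.sign (half n + A₁) : ℂ) * thetaChar A₁ B₁ τ₁ n) -
        ((∫ t in Set.Ioc (0 : ℝ) 1, eichlerIntegrand A₁ B₁ τ₁ S (pathSegment (a / c : ℝ) τ₁ ε t) *
            (τ₁ + ε - (a / c : ℝ))) +
          ∫ t in Set.Ioi (0 : ℝ), eichlerIntegrand A₁ B₁ τ₁ S (pathRay τ₁ ε t) * Complex.I) +
        ∑ n ∈ S, thetaChar A₁ B₁ τ₁ n *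
          cerf (((√Real.pi * (half n + A₁) : ℝ) : ℂ) * branchRoot τ₁ (a / c : ℝ))) *
      Complex.exp (Real.pi * Complex.I * (A₁ * B₁)) := by
  have hτ₁im : 0 < τ₁.im := by rw [hτ₁]; exact im_moebius_pos hc hdet hτ₀
  have hint := (h.integrableOn_eichlerIntegrand_pathSegment hc hdet hA hB hτ₁im hε S).mul_const
    (τ₁ + ε - (a / c : ℝ))
  have hmod : ∀ᶠ t : ℝ in 𝓝[>] 0,
      completedFalseTheta A₁ B₁ τ₁ (branchRoot τ₁ (pathSegment (a / c : ℝ) τ₁ ε t)) =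
      v * csqrt (c * τ₀ + d) * Complex.exp (Real.pi * Complex.I * (A₀ * B₀)) *
        completedFalseTheta A₀ B₀ τ₀ (moebiusRoot a c (c * τ₀ + d) τ₁
          (branchRoot τ₁ (pathSegment (a / c : ℝ) τ₁ ε t))) /
        Complex.exp (Real.pi * Complex.I * (A₁ * B₁)) := by
    filter_upwards [self_mem_nhdsWithin] with t ht
    have ht0 : 0 < t := ht
    rw [eq_div_iff (Complex.exp_ne_zero _)]
    refine h.completedFalseTheta_moebius hc hdet hA hB hτ₀ hτ₁ ?_
    rw [add_I_mul_branchRoot_sq, im_pathSegment]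
    positivity
  set r : ℝ := a / c with hr
  set P₁ := Complex.exp (Real.pi * Complex.I * (A₁ * B₁)) with hP₁
  set P₀ := Complex.exp (Real.pi * Complex.I * (A₀ * B₀)) with hP₀
  -- Limit at the cusp: modularity turns the full series into the false theta function at `τ₀`,
  -- while the omitted terms are simply evaluated at `r`.
  have hstart : Tendsto (fun t : ℝ => truncCompleted A₁ B₁ τ₁ S (pathSegment r τ₁ ε t)) (𝓝[>] 0)
      (𝓝 (v * csqrt (c * τ₀ + d) * P₀ *
        (∑' n, (Real.sign (half n + A₀) : ℂ) * thetaChar A₀ B₀ τ₀ n) / P₁ -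
        ∑ n ∈ S, thetaChar A₁ B₁ τ₁ n *
          cerf (((√Real.pi * (half n + A₁) : ℝ) : ℂ) * branchRoot τ₁ r))) := by
    refine Tendsto.sub ?_ (tendsto_finsetSum _ fun n _ => ?_)
    · exact (((tendsto_completedFalseTheta A₀ B₀ hτ₀
        (eventually_re_moebiusRoot_pos hc hdet hτ₀ hτ₁ hε)
        (tendsto_re_moebiusRoot_sq hc hdet hτ₀ hτ₁)).const_mul _).div_const _).congr'
        (hmod.mono fun t ht => ht.symm)
    · have hp0 : pathSegment r τ₁ ε 0 = r := by simp [pathSegment]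
      have hslit := I_mul_pathSegment_sub_mem r hτ₁im hε zero_le_one
      have h1 : ContinuousAt (fun t : ℝ => branchRoot τ₁ (pathSegment r τ₁ ε t)) 0 :=
        ContinuousAt.comp (f := pathSegment r τ₁ ε) (hasDerivAt_branchRoot hslit).continuousAt
          (continuous_pathSegment r τ₁ ε).continuousAt
      have h2 := (h1.tendsto.mono_left (nhdsWithin_le_nhds (s := Set.Ioi 0)))
      rw [hp0] at h2
      exact ((continuous_cerf.tendsto _).comp (h2.const_mul _)).const_mul _
  have hderiv : ∀ t ∈ Set.Ioc (0 : ℝ) 1, HasDerivAt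
      (fun t : ℝ => truncCompleted A₁ B₁ τ₁ S (pathSegment r τ₁ ε t))
      (eichlerIntegrand A₁ B₁ τ₁ S (pathSegment r τ₁ ε t) * (τ₁ + ε - r)) t := fun t ht =>
    (hasDerivAt_truncCompleted A₁ B₁ S hτ₁im (by
      rw [im_pathSegment]; exact mul_pos ht.1 hτ₁im)
      (I_mul_pathSegment_sub_mem r hτ₁im hε ht.2)).comp t (hasDerivAt_pathSegment r τ₁ ε t)
  have hseg := intervalIntegral.integral_eq_sub_of_hasDerivAt_of_tendsto one_pos
    (fun t ht => hderiv t ⟨ht.1, ht.2.le⟩)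
    ((intervalIntegrable_iff_integrableOn_Ioc_of_le zero_le_one).2 hint) hstart
    ((hderiv 1 ⟨one_pos, le_rfl⟩).continuousAt.tendsto.mono_left nhdsWithin_le_nhds)
  rw [intervalIntegral.integral_of_le zero_le_one,
    show pathSegment r τ₁ ε 1 = τ₁ + ε by simp [pathSegment]] at hseg
  -- The values at the corner `τ₁ + ε` cancel between the two pieces of the path.
  rw [hseg, integral_eichlerIntegrand_pathRay A₁ B₁ S hτ₁im hε]
  have hP₁0 : P₁ ≠ 0 := Complex.exp_ne_zero _
  have hcancel := div_mul_cancel₀ (v * csqrt (c * τ₀ + d) * P₀ *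
    ∑' n, (Real.sign (half n + A₀) : ℂ) * thetaChar A₀ B₀ τ₀ n) hP₁0
  linear_combination -hcancel

end

/-! ### The false theta function in terms of characteristics -/

section
variable {z τ : ℂ} {A B : ℝ}

theorem im_div_im_eq (hτ : 0 < τ.im) (hz : z = B + A * τ) : z.im / τ.im = A := by
  rw [hz]
  simp [hτ.ne']

/-- Completing the square in `m` costs the factor `exp(-π i A² τ)`, independent of `m`; since `z₂/τ₂
= A`, the sign becomes `sgn(m + A)`. -/
theorem psiTerm_eq (hτ : 0 < τ.im) (hz : z = B + A * τ) (n : ℤ) :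
    psiTerm z τ n = Complex.exp (-(Real.pi * Complex.I * A ^ 2 * τ)) *
      ((Real.sign (half n + A) : ℂ) * thetaChar A B τ n) := by
  have h : Complex.exp (Real.pi * Complex.I * (half n : ℂ) ^ 2 * τ) *
      Complex.exp (2 * Real.pi * Complex.I * (half n : ℂ) * z) =
      Complex.exp (-(Real.pi * Complex.I * A ^ 2 * τ)) *
      Complex.exp (Real.pi * Complex.I * ((half n + A : ℝ) : ℂ) ^ 2 * τ +
        2 * Real.pi * Complex.I * (half n : ℂ) * B) := by
    rw [← Complex.exp_add, ← Complex.exp_add, hz]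
    congr 1
    push_cast
    ring
  rw [psiTerm, thetaChar, im_div_im_eq hτ hz, mul_assoc, h]
  ring

theorem exp_mul_eq_thetaChar (hz : z = B + A * τ) (n : ℤ) :
    (-1) ^ n * Complex.exp (Real.pi * Complex.I * (half n : ℂ) ^ 2 * τ +
      2 * Real.pi * Complex.I * (half n : ℂ) * z) =
      Complex.exp (-(Real.pi * Complex.I * A ^ 2 * τ)) * thetaChar A B τ n := by
  rw [thetaChar, mul_left_comm, ← Complex.exp_add, hz]
  congr 2
  push_cast
  ring

theorem eichlerTerm_eq (hτ : 0 < τ.im) (hz : z = B + A * τ) (w : ℂ) (n : ℤ) :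
    Complex.exp (Real.pi * Complex.I * A ^ 2 * w) * eichlerTerm z τ w n =
      ((half n + A : ℝ) : ℂ) * thetaChar A B w n := by
  have h : Complex.exp (Real.pi * Complex.I * A ^ 2 * w) *
      Complex.exp (Real.pi * Complex.I * ((half n : ℂ) ^ 2 * w +
        2 * (half n : ℂ) * (z + (w - τ) * (A : ℂ)))) =
      Complex.exp (Real.pi * Complex.I * ((half n + A : ℝ) : ℂ) ^ 2 * w +
        2 * Real.pi * Complex.I * (half n : ℂ) * B) := by
    rw [← Complex.exp_add, hz]
    congr 1
    push_cast
    ring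
  rw [eichlerTerm, thetaChar, im_div_im_eq hτ hz, ← h]
  ring

theorem summable_psiTerm (hτ : 0 < τ.im) (hz : z = B + A * τ) : Summable (psiTerm z τ) := by
  rw [funext (psiTerm_eq hτ hz)]
  exact (summable_sign_mul_thetaChar A B hτ).mul_left _

theorem summable_eichlerTerm (hτ : 0 < τ.im) (hz : z = B + A * τ) {w : ℂ} (hw : 0 < w.im) :
    Summable (eichlerTerm z τ w) := by
  refine ((summable_mul_thetaChar A B hw).mul_left
    (Complex.exp (Real.pi * Complex.I * A ^ 2 * w))⁻¹).congr fun n => ?_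
  rw [← eichlerTerm_eq hτ hz, inv_mul_cancel_left₀ (Complex.exp_ne_zero _)]

theorem psi_eq (hτ : 0 < τ.im) (hz : z = B + A * τ) :
    psi z τ = Complex.I * (Complex.exp (-(Real.pi * Complex.I * A ^ 2 * τ)) *
      ∑' n, (Real.sign (half n + A) : ℂ) * thetaChar A B τ n) := by
  rw [psi]
  congr 1
  rw [← tsum_mul_left]
  simp_rw [psiTerm_eq hτ hz]

theorem truncPsi_eq (h : ℤ) (k : ℕ) (hτ : 0 < τ.im) (hz : z = B + A * τ) :
    truncPsi h k z τ = Complex.I * (Complex.exp (-(Real.pi * Complex.I * A ^ 2 * τ)) *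
      ∑' n : ((↑(near h k) : Set ℤ)ᶜ : Set ℤ),
        (Real.sign (half n + A) : ℂ) * thetaChar A B τ n) := by
  rw [truncPsi]
  congr 1
  rw [← tsum_mul_left]
  simp_rw [psiTerm_eq hτ hz]
  rfl

theorem truncEichlerIntegrand_eq (h : ℤ) (k : ℕ) (hτ : 0 < τ.im) (hz : z = B + A * τ) (w : ℂ) :
    truncEichlerIntegrand h k z τ w = eichlerIntegrand A B τ (near h k) w := by
  rw [truncEichlerIntegrand, eichlerIntegrand, ← tsum_mul_left, im_div_im_eq hτ hz]
  simp_rw [eichlerTerm_eq hτ hz]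
  rfl

theorem truncEichler_eq (h : ℤ) (k : ℕ) (r ε : ℝ) (hτ : 0 < τ.im) (hz : z = B + A * τ) :
    truncEichler h k r ε z τ = Complex.exp (-(Real.pi * Complex.I * r * A ^ 2)) *
      ((∫ t in Set.Ioc (0 : ℝ) 1, eichlerIntegrand A B τ (near h k) (pathSegment r τ ε t) *
          (τ + ε - r)) +
        ∫ t in Set.Ioi (0 : ℝ), eichlerIntegrand A B τ (near h k) (pathRay τ ε t) *
          Complex.I) := by
  rw [truncEichler, im_div_im_eq hτ hz]
  simp_rw [truncEichlerIntegrand_eq h k hτ hz]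

end

/-! ### Arithmetic of the parameters -/

theorem gcd_mul_bigK (k : ℕ) : Nat.gcd k 6 * bigK k = k :=
  Nat.mul_div_cancel' (Nat.gcd_dvd_left k 6)

theorem gcd_mul_bigH (h : ℤ) (k : ℕ) : (Nat.gcd k 6 : ℤ) * bigH h k = 6 * h := by
  refine Int.mul_ediv_cancel' (Dvd.dvd.mul_right ?_ h)
  exact_mod_cast Nat.gcd_dvd_right k 6

theorem bigK_pos {k : ℕ} (hk : 0 < k) : 0 < bigK k :=
  Nat.div_pos (Nat.le_of_dvd hk (Nat.gcd_dvd_left k 6)) (Nat.gcd_pos_of_pos_left 6 hk)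

theorem isCoprime_bigH_bigK {h : ℤ} {k : ℕ} (hk : 0 < k) (hcop : Int.gcd h k = 1) :
    IsCoprime (bigH h k) (bigK k : ℤ) := by
  have hg : 0 < Nat.gcd k 6 := Nat.gcd_pos_of_pos_left 6 hk
  have h1 : bigH h k = ((6 / Nat.gcd k 6 : ℕ) : ℤ) * h := by
    have h2 : (Nat.gcd k 6 : ℤ) * ((6 / Nat.gcd k 6 : ℕ) : ℤ) = 6 := by
      exact_mod_cast Nat.mul_div_cancel' (Nat.gcd_dvd_right k 6)
    apply mul_left_cancel₀ (show (Nat.gcd k 6 : ℤ) ≠ 0 by exact_mod_cast hg.ne')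
    rw [gcd_mul_bigH, ← mul_assoc, h2]
  rw [h1]
  refine IsCoprime.mul_left ?_ ?_
  · exact Nat.isCoprime_iff_coprime.2 (Nat.coprime_div_gcd_div_gcd hg).symm
  · refine IsCoprime.of_isCoprime_of_dvd_right (Int.isCoprime_iff_gcd_eq_one.2 hcop) ?_
    exact_mod_cast Dvd.intro_left _ (gcd_mul_bigK k)

theorem dvd_mul_negInv_add_one {h : ℤ} {k : ℕ} (hk : 0 < k) (hcop : IsCoprime h (k : ℤ)) :
    (k : ℤ) ∣ h * negInv h k + 1 := by
  have : NeZero k := ⟨hk.ne'⟩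
  rw [← ZMod.intCast_zmod_eq_zero_iff_dvd]
  have hu : IsUnit (h : ZMod k) := by
    obtain ⟨u, w, huw⟩ := hcop
    have := congrArg (Int.cast : ℤ → ZMod k) huw
    push_cast at this
    rw [ZMod.natCast_self, mul_zero, add_zero] at this
    exact IsUnit.of_mul_eq_one_right _ this
  rw [negInv]
  push_cast
  rw [ZMod.natCast_zmod_val]
  have := ZMod.mul_inv_of_unit _ hu.neg
  linear_combination -this

theorem kroneckerOdd_ne_zero {a n : ℤ} (h : IsCoprime a n) : kroneckerOdd a n ≠ 0 := by
  rw [kroneckerOdd]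
  refine mul_ne_zero (by split_ifs <;> norm_num) (jacobiSym.ne_zero ?_)
  simpa [Int.gcd, Int.natAbs_abs] using Int.isCoprime_iff_gcd_eq_one.1 h

theorem etaMultiplier_ne_zero {a b c d : ℤ} (hdet : a * d - b * c = 1) :
    etaMultiplier a b c d ≠ 0 := by
  have h : IsCoprime c d := ⟨-b, a, by linear_combination hdet⟩
  rw [etaMultiplier]
  split_ifs
  · refine mul_ne_zero (Int.cast_ne_zero.2 (kroneckerOdd_ne_zero ?_)) (Complex.exp_ne_zero _)
    exact (IsCoprime.abs_right_iff d c).2 h.symm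
  · exact mul_ne_zero (Int.cast_ne_zero.2 (kroneckerOdd_ne_zero h)) (Complex.exp_ne_zero _)

end

/-! ### Specialisation to the matrix `([-H]_K, b; K, -H)` and the characteristic `A₀ = -1/6`, `B₀ =
3z + 1/2`. -/

theorem corollary3p5 (h : ℤ) (k : ℕ) (hk : 0 < k) (hcop : Int.gcd h k = 1)
    (Z : ℂ) (hZ : 0 < Z.re) (z : ℝ) (ε : ℝ) (hε : 0 < ε) :
    let H : ℤ := bigH h k
    let K : ℕ := bigK k
    let a : ℤ := negInv H K
    let W : ℂ := 6 / (Nat.gcd k 6 : ℂ) * Z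
    let β : ℂ := 3 * (z : ℂ) - (h : ℂ) / (k : ℂ) + 1 / 2
    -- the arguments on the left-hand side
    let z₀ : ℂ := 3 * (z : ℂ) - (h : ℂ) / (k : ℂ) - Complex.I * Z / (k : ℂ) + 1 / 2
    let τ₀ : ℂ := 6 * ((h : ℂ) / (k : ℂ) + Complex.I * Z / (k : ℂ))
    -- the arguments on the right-hand side
    let z₁ : ℂ := β / (Complex.I * W) - 1 / (6 * (K : ℂ))
    let τ₁ : ℂ := (a : ℂ) / (K : ℂ) + Complex.I / ((K : ℂ) * W)
    let r : ℝ := (a : ℝ) / (K : ℝ)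
    -- all series and integrals involved converge absolutely
    Summable (psiTerm z₀ τ₀) ∧
    Summable (fun n : far h k => psiTerm z₁ τ₁ n) ∧
    (∀ w : ℂ, 0 < w.im → Summable (fun n : far h k => eichlerTerm z₁ τ₁ w n)) ∧
    MeasureTheory.IntegrableOn
      (fun s : ℝ => truncEichlerIntegrand h k z₁ τ₁ (pathSegment r τ₁ ε s)) (Set.Ioc 0 1) ∧
    MeasureTheory.IntegrableOn
      (fun t : ℝ => truncEichlerIntegrand h k z₁ τ₁ (pathRay τ₁ ε t)) (Set.Ioi 0) ∧
    -- the transformation law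
    psi z₀ τ₀ =
      etaMultiplier a (-((H * a + 1) / (K : ℤ))) (K : ℤ) (-H) ^ (-3 : ℤ) *
        (Complex.I * W) ^ (-1 / 2 : ℂ) *
        Complex.exp (-(Real.pi * (K : ℂ) / W) * (β - Complex.I * Z / (k : ℂ)) ^ 2) *
        (truncPsi h k z₁ τ₁
          - Complex.I * Complex.exp (Real.pi * (K : ℂ) * β ^ 2 / W) *
              truncEichler h k r ε z₁ τ₁
          + Complex.I * ∑ n ∈ near h k, (-1) ^ n *
              Complex.exp (Real.pi * Complex.I * (half n : ℂ) ^ 2 * τ₁ +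
                2 * Real.pi * Complex.I * (half n : ℂ) * z₁) *
              cerf (Complex.I *
                ((3 * (K : ℝ) * z + alphaHK h k - half n : ℝ) : ℂ) *
                csqrt (Real.pi / ((K : ℂ) * W)))) := by

  intro H K a W β z₀ τ₀ z₁ τ₁ r
  have hKpos : 0 < K := bigK_pos hk
  have hcopHK : IsCoprime H (K : ℤ) := isCoprime_bigH_bigK hk hcop
  set b : ℤ := -((H * a + 1) / (K : ℤ)) with hb
  have hbK : b * K = -(H * a + 1) := by
    rw [hb, neg_mul, Int.ediv_mul_cancel (dvd_mul_negInv_add_one hKpos hcopHK)]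
  have hc : 0 < (K : ℤ) := by exact_mod_cast hKpos
  have hdet : a * (-H) - b * (K : ℤ) = 1 := by rw [hbK]; ring
  have htrans := thetaTransforms_etaMultiplier a b K (-H) hc hdet
  -- the parameters in terms of `g = gcd k 6`, `K` and `H`
  set g : ℕ := Nat.gcd k 6 with hg
  have hgpos : 0 < g := Nat.gcd_pos_of_pos_left 6 hk
  have hgC : (g : ℂ) ≠ 0 := by exact_mod_cast hgpos.ne'
  have hKC : (K : ℂ) ≠ 0 := by exact_mod_cast hKpos.ne'
  have hKR : (0 : ℝ) < K := by exact_mod_cast hKpos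
  have hkC : (k : ℂ) = g * K := by exact_mod_cast (gcd_mul_bigK k).symm
  have hhC : (h : ℂ) = g * H / 6 := by
    have : (g : ℂ) * H = 6 * h := by exact_mod_cast gcd_mul_bigH h k
    rw [this]; ring
  have hbC : (b : ℂ) * K = -(H * a + 1) := by exact_mod_cast hbK
  have hbR : (b : ℝ) * K = -(H * a + 1) := by exact_mod_cast hbK
  have hWre : 0 < W.re := by
    have : W = ((6 / g : ℝ) : ℂ) * Z := by simp only [W]; push_cast; rfl
    rw [this, Complex.re_ofReal_mul]
    positivity
  have hW0 : W ≠ 0 := by intro h; rw [h] at hWre; simp at hWre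
  have hZ : Z = g * W / 6 := by
    rw [show W = 6 / (g : ℂ) * Z from rfl]; field_simp
  have hβ : β = 3 * z - H / (6 * K) + 1 / 2 := by
    simp only [β]; rw [hhC, hkC]; field_simp
  have hτ₀ : τ₀ = (H + Complex.I * W) / K := by
    simp only [τ₀]; rw [hhC, hkC, hZ]; field_simp
  -- The automorphy factor of the chosen matrix at `τ₀`.
  have hJ : ((K : ℤ) : ℂ) * τ₀ + ((-H : ℤ) : ℂ) = Complex.I * W := by
    rw [hτ₀]; push_cast; field_simp; ring
  have hτ₀im : 0 < τ₀.im := by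
    have h1 : τ₀ = ((K⁻¹ : ℝ) : ℂ) * (((H : ℝ) : ℂ) + Complex.I * W) := by
      rw [hτ₀]; push_cast; field_simp
    rw [h1, Complex.im_ofReal_mul]
    simp only [Complex.add_im, Complex.ofReal_im, Complex.mul_im, Complex.I_re, Complex.I_im]
    have := inv_pos.2 hKR
    simpa using mul_pos this hWre
  have hτ₁ : τ₁ = (a * τ₀ + b) / (((K : ℤ) : ℂ) * τ₀ + ((-H : ℤ) : ℂ)) := by
    rw [hJ, hτ₀]
    simp only [τ₁]
    field_simp
    linear_combination -hbC + Complex.I_sq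
  have hτ₁im : 0 < τ₁.im := by rw [hτ₁]; exact im_moebius_pos hc hdet hτ₀im
  -- the characteristics
  set A₀ : ℝ := -1 / 6 with hA₀
  set B₀ : ℝ := 3 * z + 1 / 2 with hB₀
  set A₁ : ℝ := -(3 * (K : ℝ) * z + alphaHK h k) with hA₁
  set B₁ : ℝ := a * (3 * z - H / (6 * K) + 1 / 2) - 1 / (6 * K) with hB₁
  have hα : alphaHK h k = (K : ℝ) / 2 - (H : ℝ) / 6 := rfl
  have hA : A₀ = ((K : ℤ) : ℝ) * B₁ + a * A₁ := by
    rw [hA₀, hA₁, hB₁, hα]; push_cast; field_simp; ring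
  have hB : B₀ = ((-H : ℤ) : ℝ) * B₁ + b * A₁ := by
    have hbR' : (b : ℝ) = -(H * a + 1) / K := by rw [← hbR]; field_simp
    rw [hB₀, hA₁, hB₁, hα, hbR']; push_cast; field_simp; ring
  have hz₀ : z₀ = B₀ + A₀ * τ₀ := by
    simp only [z₀, τ₀, hB₀, hA₀]; push_cast; ring
  have hA₁β : (A₁ : ℂ) = -(K * β) := by
    rw [hβ, hA₁, hα]; push_cast; field_simp; ring
  have hz₁ : z₁ = B₁ + A₁ * τ₁ := by
    have hB₁C : (B₁ : ℂ) = a * β - 1 / (6 * K) := by rw [hβ, hB₁]; push_cast; ring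
    rw [hA₁β, hB₁C]
    simp only [z₁, τ₁]
    field_simp
    linear_combination (6 * K * β) * Complex.I_sq
  have hr : r = (a : ℝ) / ((K : ℤ) : ℝ) := by simp only [r]; push_cast; rfl
  have hmain := htrans.falseTheta hc hdet hA hB hτ₀im hτ₁ hε (near h k)
  have hint := htrans.integrableOn_eichlerIntegrand_pathSegment hc hdet hA hB hτ₁im hε (near h k)
  have hchar := (characteristic_identities hdet hA hB (τ := τ₀) (by
    rw [hJ]; exact mul_ne_zero Complex.I_ne_zero hW0)).2.2
  rw [← hr] at hmain hint
  rw [← hτ₁] at hchar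
  refine ⟨summable_psiTerm hτ₀im hz₀, (summable_psiTerm hτ₁im hz₁).subtype _,
    fun w hw => (summable_eichlerTerm hτ₁im hz₁ hw).subtype _, ?_, ?_, ?_⟩
  · simp_rw [truncEichlerIntegrand_eq h k hτ₁im hz₁]
    exact hint
  · simp_rw [truncEichlerIntegrand_eq h k hτ₁im hz₁]
    exact integrableOn_eichlerIntegrand_pathRay A₁ B₁ (near h k) hτ₁im hε
  rw [psi_eq hτ₀im hz₀, truncPsi_eq h k hτ₁im hz₁, truncEichler_eq h k r ε hτ₁im hz₁]
  simp_rw [exp_mul_eq_thetaChar hz₁]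
  -- At the cusp `i(r - τ₁) = 1/(KW)`, and `m + A₁ = -(3Kz + α - m)`; this sign meets the `-i` in
  -- `branchRoot`.
  have hnear : ∀ n : ℤ, Complex.I * ((3 * (K : ℝ) * z + alphaHK h k - half n : ℝ) : ℂ) *
      csqrt (Real.pi / ((K : ℂ) * W)) =
      ((√Real.pi * (half n + A₁) : ℝ) : ℂ) * branchRoot τ₁ r := by
    intro n
    have hKW : 0 < ((K : ℂ) * W).re := by
      rw [← Complex.ofReal_natCast, Complex.re_ofReal_mul]
      exact mul_pos hKR hWre
    have h1 : Complex.I * (r - τ₁) = ((K : ℂ) * W)⁻¹ := by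
      simp only [r, τ₁]
      push_cast
      field_simp
      linear_combination -Complex.I_sq
    rw [branchRoot, h1, div_eq_mul_inv, csqrt_ofReal_mul Real.pi_pos
      (Complex.mem_slitPlane_iff.2 (Or.inl (inv_re_pos hKW))), hA₁]
    push_cast
    ring
  simp_rw [hnear]
  have hfac : ∀ (E : ℂ) (f g : ℤ → ℂ),
      ∑ n ∈ near h k, E * f n * g n = E * ∑ n ∈ near h k, f n * g n := by
    intro E f g
    simp_rw [mul_assoc, ← Finset.mul_sum]
  rw [hfac]
  -- Since `A₁ = -Kβ` and `τ₁ - r = i/(KW)`, the factor `exp(πKβ²/W)` moves the base point of the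
  -- prefactor of `𝔼` from the cusp to `τ₁`. All three terms then share one factor.
  have hE : Complex.exp (Real.pi * (K : ℂ) * β ^ 2 / W) *
      Complex.exp (-(Real.pi * Complex.I * r * A₁ ^ 2)) =
      Complex.exp (-(Real.pi * Complex.I * A₁ ^ 2 * τ₁)) := by
    rw [← Complex.exp_add, hA₁β]
    congr 1
    simp only [r, τ₁]
    push_cast
    field_simp
    linear_combination β ^ 2 * Complex.I_sq
  -- The third of the `characteristic_identities`, exponentiated, with `β - iZ/k = z₀ = B₀ + A₀ τ₀`.
  have hpref : Complex.exp (-(Real.pi * (K : ℂ) / W) * (β - Complex.I * Z / (k : ℂ)) ^ 2) *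
      Complex.exp (-(Real.pi * Complex.I * A₁ ^ 2 * τ₁)) *
      Complex.exp (Real.pi * Complex.I * (A₀ * B₀)) =
      Complex.exp (-(Real.pi * Complex.I * A₀ ^ 2 * τ₀)) *
        Complex.exp (Real.pi * Complex.I * (A₁ * B₁)) := by
    simp only [← Complex.exp_add]
    congr 1
    have h1 : β - Complex.I * Z / (k : ℂ) = B₀ + A₀ * τ₀ := by
      rw [← hz₀]; simp only [β, z₀]; ring
    rw [hJ] at hchar
    have h2 : -(Real.pi * (K : ℂ) / W) * (B₀ + A₀ * τ₀) ^ 2 =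
        -(Real.pi * Complex.I) * (((K : ℤ) : ℂ) * (B₀ + A₀ * τ₀) ^ 2 / (Complex.I * W)) := by
      push_cast
      field_simp
    rw [h1, h2]
    linear_combination -(Real.pi * Complex.I) * hchar
  have hv0 : etaMultiplier a b (K : ℤ) (-H) ≠ 0 := etaMultiplier_ne_zero hdet
  have hj0 : csqrt (Complex.I * W) ≠ 0 := csqrt_ne_zero (mul_ne_zero Complex.I_ne_zero hW0)
  have hj : (Complex.I * W) ^ (-1 / 2 : ℂ) = (csqrt (Complex.I * W))⁻¹ := by
    rw [csqrt, ← Complex.cpow_neg, neg_div]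
  rw [hj, zpow_neg]
  have hv3 := zpow_ne_zero 3 hv0
  rw [hJ] at hmain
  have hP₁ : Complex.exp (Real.pi * Complex.I * (A₁ * B₁)) ≠ 0 := Complex.exp_ne_zero _
  generalize etaMultiplier a b (K : ℤ) (-H) ^ (3 : ℤ) = v at *
  generalize csqrt (Complex.I * W) = j at *
  generalize Complex.exp (Real.pi * Complex.I * (A₁ * B₁)) = P₁ at *
  generalize Complex.exp (Real.pi * Complex.I * (A₀ * B₀)) = P₀ at *
  generalize Complex.exp (-(Real.pi * Complex.I * A₁ ^ 2 * τ₁)) = E₁ at *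
  generalize Complex.exp (-(Real.pi * Complex.I * A₀ ^ 2 * τ₀)) = E₀ at *
  generalize Complex.exp (-(Real.pi * (K : ℂ) / W) * (β - Complex.I * Z / (k : ℂ)) ^ 2) = p at *
  generalize Complex.exp (Real.pi * (K : ℂ) * β ^ 2 / W) = e at *
  generalize Complex.exp (-(Real.pi * Complex.I * r * A₁ ^ 2)) = f at *
  generalize (∑' n, (Real.sign (half n + A₀) : ℂ) * thetaChar A₀ B₀ τ₀ n) = S₀ at *
  generalize (∑' n : ((↑(near h k) : Set ℤ)ᶜ : Set ℤ),
    (Real.sign (half n + A₁) : ℂ) * thetaChar A₁ B₁ τ₁ n) = S₁ at *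
  generalize (∑ n ∈ near h k, thetaChar A₁ B₁ τ₁ n *
    cerf (((√Real.pi * (half n + A₁) : ℝ) : ℂ) * branchRoot τ₁ r)) = N at *
  generalize ((∫ t in Set.Ioc (0 : ℝ) 1, eichlerIntegrand A₁ B₁ τ₁ (near h k)
    (pathSegment r τ₁ ε t) * (τ₁ + ε - r)) + ∫ t in Set.Ioi (0 : ℝ),
    eichlerIntegrand A₁ B₁ τ₁ (near h k) (pathRay τ₁ ε t) * Complex.I) = T at *
  have hbracket : Complex.I * (E₁ * S₁) - Complex.I * e * (f * T) + Complex.I * (E₁ * N) =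
      Complex.I * E₁ * (v * j * P₀ * S₀ / P₁) := by
    rw [hmain, mul_div_cancel_right₀ _ hP₁]
    linear_combination -Complex.I * T * hE
  rw [hbracket]
  field_simp
  linear_combination -S₀ * hpref
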